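/- All entropies and mutual informations are in bits; $\ln$ is the natural logarithm. **Model.** Let $P_\Theta$ be a prior on a finite set $\mathcal T$ and let $p\in(0,1)$. There are $K$ records. The tuples $(\Theta_i,T_i,Z_i,V_i)$, $1\le i\le K$, are i.i.d., where: $\Theta_i\sim P_\Theta$ is independent of $(T_i,Z_i)$; the type $T_i\in\{0,1\}$ has $\mathbb P(T_i=1)=p$; $Z_i$ is a screening statistic in an arbitrary measurable space; and the verification output $V_i$ (in an arbitrary measurable space) is conditionally independent of $Z_i$ given $(\Theta_i,T_i)$, is generated from $(\Theta_i,T_i)$ by a fixed channel, and is independent of $\Theta_i$ given $T_i=0$. Put $\Theta=(\Theta_1,\dots,\Theta_K)$, $J=\mathrm I(T;Z)$ and $I_{\mathrm{ver}}=\mathrm I(\Theta_1;V_1\mid T_1=1)$. A policy with budgets $(K,B)$ selects, as a (possibly privately randomized) function of $Z_1,\dots,Z_K$, a set $\mathcal B\subseteq\{1,\dots,K\}$ with $|\mathcal B|\le B$ almost surely. One then observes $Z_1,\dots,Z_K$ and $Y_1,\dots,Y_K$, where $Y_i=(T_i,V_i)$ if $i\in\mathcal B$ and $Y_i=\bot$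 otherwise. $D^\star(K,B)$ is the infimum, over all policies with budgets $(K,B)$ and all predictors (measurable functions of the observation with values in the probability distributions on $\mathcal T^K$), of the expected log-loss in predicting $\Theta$. **Weak-screening regime.** Fix $\alpha\in(0,1)$, $P_\Theta$, $p$, the verification channel, and the law of a real random variable $G$ with a continuous distribution function, $\mathbb E[G]=0$, $\mathbb E[G^2]=1$ and $\mathbb E|G|^3<\infty$. The law of $(T,Z)$ varies with a parameter $\varepsilon\ge 0$ in such a way that the Bayes score $\eta(Z)=\mathbb P(T=1\mid Z)\in(0,1)$ satisfies, almost surely, $$\ln\frac{\eta(Z)}{1-\eta(Z)}=b_\varepsilon+\varepsilon G$$ for some real intercept $b_\varepsilon$ (for instance $b_\varepsilon=\ln\frac{p}{1-p}$ whenever that is compatible with $\mathbb E[\eta(Z)]=p$). Let $q_\alpha=\inf\{q:\mathbb P(G\le q)\ge 1-\alpha\}$, and let $$m_G(\alpha)=\frac1\alpha\,\mathbb E\big[G\,\mathbf 1\{G\ge q_\alpha\}\big],\qquad c_G(p,\alpha)=\sqrt{2\ln 2\;p(1-p)\,\alpha}\;m_G(\alpha).$$ **Claim.** With $B=\lfloor\alpha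 K\rfloor$, in the joint limit $\varepsilon\to0$ and $K\to\infty$, $$\mathrm H(\Theta)-D^\star(K,B)\;\ge\; I_{\mathrm{ver}}\big(Bp+c_G(p,\alpha)\sqrt{JKB}\big)+o\big(\sqrt{JKB}\big),$$ and for all these $\varepsilon$ and $K$ $$\mathrm H(\Theta)-D^\star(K,B)\;\le\; I_{\mathrm{ver}}\Big(Bp+\sqrt{\tfrac{\ln 2}{2}\,JKB}\Big).$$ Moreover $c_G(p,\alpha)>0$, so that the $\sqrt{JKB}$ scaling is tight up to constants. -/

import Mathlib

open MeasureTheory ProbabilityTheory Filter Topology Asymptotics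
open scoped ENNReal

noncomputable section

namespace Haystack

/-! Information measures, in bits. -/

/-- Shannon entropy in bits of a law on a finite set. -/
def entropyBits {A : Type*} [Fintype A] [MeasurableSpace A] (μ : Measure A) : ℝ :=
  ∑ a, Real.negMulLog (μ.real {a}) / Real.log 2

/-- Mutual information in bits between the two coordinates of a joint law: the relative entropy of
the joint law with respect to the product of its marginals. (It is finite as soon as one of the
two coordinates is finite-valued, which is the case wherever it is used below.) -/
def mutualInfoBits {A B : Type*} [MeasurableSpace A] [MeasurableSpace B]
    (μ : Measure (A × B)) : ℝ :=
  (InformationTheory.klDiv μ (μ.fst.prod μ.snd)).toReal / Real.log 2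

/-- The log-loss in bits `-log₂ q` of having assigned probability `q` to the true value. -/
def logLossBits (q : ℝ≥0∞) : ℝ≥0∞ :=
  if q = 0 then ⊤ else ENNReal.ofReal (-Real.logb 2 q.toReal)

/-- Bayes-optimal expected log-loss, in bits, for predicting the first coordinate (the state) after
observing the second: the infimum, over all predictors that output a probability distribution on
the states as a measurable function of the observation, of the expected log-loss. -/
def bayesLogLoss {A O : Type*} [MeasurableSpace A] [MeasurableSpace O]
    (ρ : Measure (A × O)) : ℝ≥0∞ :=
  ⨅ q : {κ : Kernel O A // IsMarkovKernel κ}, ∫⁻ x, logLossBits (q.1 x.2 {x.1}) ∂ρ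

/-! Screening. The type `T` of a record is a `Bool` (`true` for informative); the law of the pair
`(T, Z)` is a probability measure on `Bool × 𝒵`. -/

/-- The Bayes score `η(z) = P(T = 1 | Z = z)`. -/
def bayesScore {𝒵 : Type*} [MeasurableSpace 𝒵] (R : Measure (Bool × 𝒵)) [IsFiniteMeasure R]
    (z : 𝒵) : ℝ :=
  (condDistrib (Prod.fst : Bool × 𝒵 → Bool) Prod.snd R z).real {true}

/-- `γ` is the law of a standardized score `G`: mean zero, unit variance, finite third absolute
moment, and a continuous distribution (function). -/
structure IsStandardScoreLaw (γ : Measure ℝ) : Prop where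
  prob : IsProbabilityMeasure γ
  third_moment : Integrable (fun g => |g| ^ 3) γ
  mean : ∫ g, g ∂γ = 0
  second_moment : ∫ g, g ^ 2 ∂γ = 1
  continuous : ∀ x, γ {x} = 0

/-- Log-odds form of the score: there is a real random variable `G` with law `γ`, on a common
probability space with `(T, Z)`, such that almost surely
`ln (η(Z) / (1 - η(Z))) = b + ε G`. (The log-odds are genuine: `0 < η(Z) < 1` almost surely.) -/
def HasLogOddsScore {𝒵 : Type*} [MeasurableSpace 𝒵] (R : Measure (Bool × 𝒵)) [IsFiniteMeasure R]
    (γ : Measure ℝ) (b ε : ℝ) : Prop :=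
  ∃ ρ : Measure ((Bool × 𝒵) × ℝ), ρ.fst = R ∧ ρ.snd = γ ∧
    ∀ᵐ x ∂ρ, bayesScore R x.1.2 ∈ Set.Ioo (0 : ℝ) 1 ∧
      Real.log (bayesScore R x.1.2 / (1 - bayesScore R x.1.2)) = b + ε * x.2

/-- The `(1 - α)`-quantile `q_α = inf {q : P(G ≤ q) ≥ 1 - α}` of `G ∼ γ`. -/
def upperQuantile (γ : Measure ℝ) (α : ℝ) : ℝ :=
  sInf {q : ℝ | 1 - α ≤ γ.real (Set.Iic q)}

/-- The upper-tail mean `m_G(α) = (1/α) E[G 1{G ≥ q_α}]`. -/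
def tailMean (γ : Measure ℝ) (α : ℝ) : ℝ :=
  1 / α * ∫ g in Set.Ici (upperQuantile γ α), g ∂γ

/-- The constant `c_G(p, α) = √(2 ln 2 · p (1 - p) α) · m_G(α)`. -/
def scoreConst (γ : Measure ℝ) (p α : ℝ) : ℝ :=
  Real.sqrt (2 * Real.log 2 * p * (1 - p) * α) * tailMean γ α

/-! Verification. The conditional law of `V` given `(Θ, T)` is a Markov kernel `W`. -/

section Verification

variable {𝒯 𝒱 : Type*} [MeasurableSpace 𝒯] [MeasurableSpace 𝒱]

/-- The joint law of `(Θ, V)` given `T = t` (the state is independent of the type). -/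
def stateOutputLaw (prior : Measure 𝒯) (W : Kernel (𝒯 × Bool) 𝒱) (t : Bool) :
    Measure (𝒯 × 𝒱) :=
  prior ⊗ₘ W.comap (fun θ => (θ, t)) (by fun_prop)

/-- The verification information `I_ver = I(Θ; V | T = 1)`, in bits. -/
def verInfo (prior : Measure 𝒯) (W : Kernel (𝒯 × Bool) 𝒱) : ℝ :=
  mutualInfoBits (stateOutputLaw prior W true)

end Verification

/-! The model with `K` records and policies with budgets `(K, B)`. -/

section Model

variable {𝒯 𝒵 𝒱 : Type*} [MeasurableSpace 𝒯] [MeasurableSpace 𝒵] [MeasurableSpace 𝒱]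

/-- The joint law of one record `((Θᵢ, (Tᵢ, Zᵢ)), Vᵢ)`: the claim `Θᵢ` is independent of `(Tᵢ, Zᵢ)`,
and `Vᵢ` is generated from `(Θᵢ, Tᵢ)` by the verification channel. -/
def recordLaw (prior : Measure 𝒯) (R : Measure (Bool × 𝒵)) (W : Kernel (𝒯 × Bool) 𝒱) :
    Measure ((𝒯 × (Bool × 𝒵)) × 𝒱) :=
  (prior.prod R) ⊗ₘ W.comap (fun x => (x.1, x.2.1)) (by fun_prop)

/-- The joint law of `K` independent records with decoupled claims. -/
def recordsLaw (prior : Measure 𝒯) (R : Measure (Bool × 𝒵)) (W : Kernel (𝒯 × Bool) 𝒱) (K : ℕ) :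
    Measure (Fin K → (𝒯 × (Bool × 𝒵)) × 𝒱) :=
  Measure.pi fun _ => recordLaw prior R W

/-- A policy with budgets `(K, B)`: given the screening statistics of the `K` inspected records, it
draws (with private randomness) the indicator vector of the set of verified records, which almost
surely has at most `B` elements. -/
structure Policy (𝒵 : Type*) [MeasurableSpace 𝒵] (K B : ℕ) where
  select : Kernel (Fin K → 𝒵) (Fin K → Bool)
  isMarkov : IsMarkovKernel select
  budget : ∀ z, ∀ᵐ S ∂(select z), (Finset.univ.filter fun i => S i = true).card ≤ B

/-- The verification transcript `Yᵢ`: the symbol `⊥` (here `Sum.inl ()`) if record `i` is not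
verified, and `(Tᵢ, Vᵢ)` if it is. -/
def transcript {K : ℕ} (x : Fin K → (𝒯 × (Bool × 𝒵)) × 𝒱) (S : Fin K → Bool) (i : Fin K) :
    Unit ⊕ (Bool × 𝒱) :=
  if S i = true then Sum.inr ((x i).1.2.1, (x i).2) else Sum.inl ()

/-- The joint law, under a policy, of the state `Θ = (Θ₁, …, Θ_K)` and the observation
`(Z₁, …, Z_K, Y₁, …, Y_K)`. -/
def outcomeLaw (prior : Measure 𝒯) (R : Measure (Bool × 𝒵)) (W : Kernel (𝒯 × Bool) 𝒱)
    {K B : ℕ} (P : Policy 𝒵 K B) :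
    Measure ((Fin K → 𝒯) × ((Fin K → 𝒵) × (Fin K → Unit ⊕ (Bool × 𝒱)))) :=
  ((recordsLaw prior R W K) ⊗ₘ
      P.select.comap (fun x i => (x i).1.2.2) (by fun_prop)).map
    fun w => (fun i => (w.1 i).1.1, (fun i => (w.1 i).1.2.2, transcript w.1 w.2))

/-- `D⋆(K, B)`: the optimal Bayes log-loss, in bits, over all policies with budgets `(K, B)`. -/
def optLogLoss (prior : Measure 𝒯) (R : Measure (Bool × 𝒵)) (W : Kernel (𝒯 × Bool) 𝒱)
    (K B : ℕ) : ℝ≥0∞ :=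
  ⨅ P : Policy 𝒵 K B, bayesLogLoss (outcomeLaw prior R W P)

/-- The optimal gain `H(Θ) - D⋆(K, B)`, in bits, where `Θ = (Θ₁, …, Θ_K)` has i.i.d. entries.
(`D⋆(K, B)` is finite, since a constant predictor has finite log-loss.) -/
def optGain [Fintype 𝒯] (prior : Measure 𝒯) (R : Measure (Bool × 𝒵)) (W : Kernel (𝒯 × Bool) 𝒱)
    (K B : ℕ) : ℝ :=
  entropyBits (Measure.pi fun _ : Fin K => prior) - (optLogLoss prior R W K B).toReal

end Model

end Haystack

end

set_option linter.unusedSectionVars false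

noncomputable section

/-! The problem reduces to counting. Selection depends only on the screening statistics, which are
independent of the states. So, given the observation, the states are independent, and each has as
its law the prior, or the informative posterior if the record was verified and found to have type 1.
The product of these laws is the Bayes predictor by Gibbs' inequality, and log-loss is additive over
products. Hence a policy gains exactly `verInfo` times `expectedHits`, the expected number of
informative records verified (`bayesLogLoss_outcomeLaw_eq`), and that number is the expected sum of
the Bayes scores η over the selected records.

Converse: hits exceed `B p` by at most the expected sum of η - p over the selected set. By
Cauchy-Schwarz this is at most √(B K Var η) (`expectedHits_le_of_variance`). Pinsker's inequality
for Bernoulli laws gives Var η ≤ (ln 2 / 2) J, since J is the expected Bernoulli relative entropy of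
η from p.

Achievability: verify the records with η at or above its (1 - α)-quantile, adjusting the set to have
exactly `B` elements. The number of such records fluctuates by O(√K). The adjustment involves
records whose scores differ from the threshold by about ε, so its cost is negligible against εK. To
first order η = p + p(1 - p) ε G, so the excess is εK · p(1 - p) α m_G
(`exists_policy_weak_screening`).

To express this through J, the divergence is expanded in log-odds coordinates: J ≤ ε² p(1 - p) / (2
ln 2) to leading order (`integral_bernoulliDiv_le`). Thus √(JKB) is at most about εK √(α p(1 - p) /
(2 ln 2)), and `scoreConst` is the constant that matches the two expressions. Conversely, Pinsker
and a lower bound on Var η make εK of order at most √(JKB), so errors o(εK) are o(√(JKB)). Finally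
m_G > 0 because G has mean zero and no atoms. -/

namespace Haystack

/-! ### Exchanging weights under product measures -/

/-- Integrals over a product measure agree if they agree after integrating out one coordinate. -/
lemma lintegral_pi_congr_update {δ : Type*} [Fintype δ] [DecidableEq δ] {X : δ → Type*}
    [∀ i, MeasurableSpace (X i)] {μ : ∀ i, Measure (X i)} [∀ i, SigmaFinite (μ i)] (i : δ)
    {f g : (∀ i, X i) → ℝ≥0∞} (hf : Measurable f) (hg : Measurable g)
    (h : ∀ x, ∫⁻ y, f (Function.update x i y) ∂μ i = ∫⁻ y, g (Function.update x i y) ∂μ i) :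
    ∫⁻ x, f x ∂Measure.pi μ = ∫⁻ x, g x ∂Measure.pi μ := by
  refine lintegral_eq_of_lmarginal_eq {i} hf hg ?_
  rw [lmarginal_singleton, lmarginal_singleton]
  exact funext h

/-- Weights `a i` on the coordinates of a product may be exchanged for weights `b i` having the same
conditional expectation given the statistic `o i`. -/
lemma lintegral_pi_prod_mul_congr {δ X Y : Type*} [Fintype δ] [DecidableEq δ]
    [MeasurableSpace X] [MeasurableSpace Y] {μ : Measure X} [SigmaFinite μ]
    {a b : δ → X → ℝ≥0∞} {o : δ → X → Y} (ha : ∀ i, Measurable (a i)) (hb : ∀ i, Measurable (b i))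
    (ho : ∀ i, Measurable (o i))
    (h : ∀ i, ∀ c : Y → ℝ≥0∞, Measurable c →
      ∫⁻ x, a i x * c (o i x) ∂μ = ∫⁻ x, b i x * c (o i x) ∂μ)
    {H : (δ → Y) → ℝ≥0∞} (hH : Measurable H) :
    ∫⁻ x, (∏ i, a i (x i)) * H (fun i => o i (x i)) ∂Measure.pi (fun _ : δ => μ)
      = ∫⁻ x, (∏ i, b i (x i)) * H (fun i => o i (x i)) ∂Measure.pi (fun _ : δ => μ) := by
  have hHo : Measurable fun x : δ → X => H (fun i => o i (x i)) := by fun_prop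
  -- The exchange is made one coordinate at a time; `s` is the set of coordinates already exchanged.
  have key : ∀ s : Finset δ,
      ∫⁻ x, (∏ i, a i (x i)) * H (fun i => o i (x i)) ∂Measure.pi (fun _ : δ => μ)
        = ∫⁻ x, ((∏ i ∈ s, b i (x i)) * ∏ i ∈ sᶜ, a i (x i)) * H (fun i => o i (x i))
            ∂Measure.pi (fun _ : δ => μ) := by
    intro s
    induction s using Finset.induction_on with
    | empty => simp
    | insert j s hj ih =>
      rw [ih]
      have hc : sᶜ = insert j (insert j s)ᶜ := by
        ext k; simp only [Finset.mem_compl, Finset.mem_insert]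
        by_cases hk : k = j <;> simp [hk, hj]
      have hj' : j ∉ (insert j s)ᶜ := by simp
      refine lintegral_pi_congr_update j (by fun_prop) (by fun_prop) fun x => ?_
      have e1 : ∀ (w : δ → X → ℝ≥0∞) (t : Finset δ), j ∉ t → ∀ y,
          ∏ i ∈ t, w i (Function.update x j y i) = ∏ i ∈ t, w i (x i) := fun w t ht y =>
        Finset.prod_congr rfl fun i hi => by
          rw [Function.update_of_ne (ne_of_mem_of_not_mem hi ht)]
      have e2 : ∀ y, (fun i => o i (Function.update x j y i))
          = Function.update (fun i => o i (x i)) j (o j y) := fun y => by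
        funext i
        by_cases hi : i = j
        · subst hi; simp
        · simp [hi]
      -- With the other coordinates frozen, the remaining weights and `H` depend on coordinate `j`
      -- only through `o j`, so together they form an admissible test function `c`.
      have key := h j (fun y => (∏ i ∈ s, b i (x i)) * (∏ i ∈ (insert j s)ᶜ, a i (x i)) *
        H (Function.update (fun i => o i (x i)) j y)) (by fun_prop)
      simp_rw [hc, Finset.prod_insert hj', Finset.prod_insert hj, e2, e1 _ _ hj, e1 _ _ hj',
        Function.update_self]
      convert key using 2 <;> funext y <;> ring
  have := key Finset.univ
  simpa using this

/-! ### Log-loss, Gibbs' inequality and Bayes-optimal prediction -/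

lemma measurable_logLossBits : Measurable logLossBits := by
  unfold logLossBits
  refine Measurable.ite (measurableSet_singleton _) measurable_const ?_
  unfold Real.logb
  fun_prop

lemma logLossBits_of_ne_zero {q : ℝ≥0∞} (h : q ≠ 0) :
    logLossBits q = ENNReal.ofReal (-Real.logb 2 q.toReal) := by simp [logLossBits, h]

lemma logb_two_toReal_nonpos {q : ℝ≥0∞} (h : q ≤ 1) : Real.logb 2 q.toReal ≤ 0 := by
  refine Real.logb_nonpos one_lt_two ENNReal.toReal_nonneg ?_
  simpa using ENNReal.toReal_mono ENNReal.one_ne_top h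

/-- The bounds by 1 keep both logarithmic terms nonnegative, so the truncation in `ENNReal.ofReal`
does not interfere with additivity. A zero factor makes both sides infinite. -/
lemma logLossBits_mul {q r : ℝ≥0∞} (hq : q ≤ 1) (hr : r ≤ 1) :
    logLossBits (q * r) = logLossBits q + logLossBits r := by
  by_cases hq0 : q = 0
  · simp [logLossBits, hq0]
  by_cases hr0 : r = 0
  · simp [logLossBits, hr0]
  have hqt : q.toReal ≠ 0 := ENNReal.toReal_ne_zero.2 ⟨hq0, (hq.trans_lt ENNReal.one_lt_top).ne⟩
  have hrt : r.toReal ≠ 0 := ENNReal.toReal_ne_zero.2 ⟨hr0, (hr.trans_lt ENNReal.one_lt_top).ne⟩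
  rw [logLossBits_of_ne_zero (mul_ne_zero hq0 hr0), logLossBits_of_ne_zero hq0,
    logLossBits_of_ne_zero hr0, ENNReal.toReal_mul, Real.logb_mul hqt hrt, neg_add,
    ENNReal.ofReal_add] <;> simp [logb_two_toReal_nonpos, hq, hr]

lemma logLossBits_one : logLossBits 1 = 0 := by simp [logLossBits]

lemma logLossBits_prod {δ : Type*} (s : Finset δ) (q : δ → ℝ≥0∞) (hq : ∀ i, q i ≤ 1) :
    logLossBits (∏ i ∈ s, q i) = ∑ i ∈ s, logLossBits (q i) := by
  classical
  induction s using Finset.induction_on with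
  | empty => simp [logLossBits_one]
  | insert j s hj ih =>
    rw [Finset.prod_insert hj, Finset.sum_insert hj,
      logLossBits_mul (hq j) (Finset.prod_le_one' fun i _ => hq i), ih]

section Finite

variable {A : Type*} [Fintype A] [MeasurableSpace A] [MeasurableSingletonClass A]

lemma sum_univ_measureReal_singleton (μ : Measure A) [IsProbabilityMeasure μ] :
    ∑ a, μ.real {a} = 1 := by
  simp [MeasureTheory.sum_measureReal_singleton]

/-- Expected log-loss of a deterministic probability vector, when it is finite. -/
lemma lintegral_logLossBits_eq_ofReal (μ : Measure A) [IsProbabilityMeasure μ] (q : A → ℝ≥0∞)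
    (hq : ∀ a, q a ≤ 1) (h0 : ∀ a, μ {a} ≠ 0 → q a ≠ 0) :
    ∫⁻ a, logLossBits (q a) ∂μ
      = ENNReal.ofReal (∑ a, μ.real {a} * -Real.logb 2 (q a).toReal) := by
  rw [lintegral_fintype, ENNReal.ofReal_sum_of_nonneg]
  · refine Finset.sum_congr rfl fun a _ => ?_
    by_cases ha : μ {a} = 0
    · simp [ha, measureReal_def]
    · rw [logLossBits_of_ne_zero (h0 a ha), mul_comm,
        ENNReal.ofReal_mul measureReal_nonneg, ofReal_measureReal]
  · exact fun a _ => mul_nonneg measureReal_nonneg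
      (neg_nonneg.2 (logb_two_toReal_nonpos (hq a)))

/-- The expected log-loss of the true law is its entropy. -/
lemma lintegral_logLossBits_self (μ : Measure A) [IsProbabilityMeasure μ] :
    ∫⁻ a, logLossBits (μ {a}) ∂μ = ENNReal.ofReal (entropyBits μ) := by
  rw [lintegral_logLossBits_eq_ofReal μ (fun a => μ {a}) (fun a => prob_le_one) fun a h => h]
  congr 1
  refine Finset.sum_congr rfl fun a _ => ?_
  rw [Real.negMulLog, Real.logb, measureReal_def]
  ring

/-- Gibbs' inequality for the log-loss. -/
lemma lintegral_logLossBits_self_le (μ ν : Measure A) [IsProbabilityMeasure μ]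
    [IsProbabilityMeasure ν] :
    ∫⁻ a, logLossBits (μ {a}) ∂μ ≤ ∫⁻ a, logLossBits (ν {a}) ∂μ := by
  by_cases h : ∀ a, μ {a} ≠ 0 → ν {a} ≠ 0
  · rw [lintegral_logLossBits_eq_ofReal μ (fun a => μ {a}) (fun a => prob_le_one) fun a h => h,
      lintegral_logLossBits_eq_ofReal μ (fun a => ν {a}) (fun a => prob_le_one) h]
    refine ENNReal.ofReal_le_ofReal ?_
    have hl2 : 0 < Real.log 2 := Real.log_pos one_lt_two
    -- The correction comes from log t ≤ t - 1 at t = ν/μ; summed over all atoms it vanishes because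
    -- both laws have total mass one.
    have key : ∀ a, μ.real {a} * -Real.logb 2 (μ {a}).toReal
        ≤ μ.real {a} * -Real.logb 2 (ν {a}).toReal
          + (ν.real {a} - μ.real {a}) / Real.log 2 := by
      intro a
      simp only [← measureReal_def, Real.logb]
      by_cases ha : μ {a} = 0
      · have : μ.real {a} = 0 := by simp [measureReal_def, ha]
        simp only [this, zero_mul, zero_add, sub_zero]
        positivity
      · have hm : 0 < μ.real {a} := ENNReal.toReal_pos ha (measure_ne_top _ _)
        have hn : 0 < ν.real {a} := ENNReal.toReal_pos (h a ha) (measure_ne_top _ _)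
        have := Real.log_le_sub_one_of_pos (div_pos hn hm)
        rw [Real.log_div hn.ne' hm.ne'] at this
        have h2 : μ.real {a} * (Real.log (ν.real {a}) - Real.log (μ.real {a}))
            ≤ ν.real {a} - μ.real {a} := by
          calc _ ≤ μ.real {a} * (ν.real {a} / μ.real {a} - 1) := by gcongr
            _ = _ := by field_simp
        have h3 := div_le_div_of_nonneg_right h2 hl2.le
        have e : μ.real {a} * (Real.log (ν.real {a}) - Real.log (μ.real {a})) / Real.log 2
          = μ.real {a} * -(Real.log (μ.real {a}) / Real.log 2)
            - μ.real {a} * -(Real.log (ν.real {a}) / Real.log 2) := by ring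
        linarith
    refine (Finset.sum_le_sum fun a _ => key a).trans ?_
    rw [Finset.sum_add_distrib, ← Finset.sum_div, Finset.sum_sub_distrib,
      sum_univ_measureReal_singleton, sum_univ_measureReal_singleton]
    simp
  · push Not at h
    obtain ⟨a, ha, hb⟩ := h
    have : ∫⁻ a, logLossBits (ν {a}) ∂μ = ⊤ := by
      rw [lintegral_fintype]
      refine ENNReal.sum_eq_top.2 ⟨a, Finset.mem_univ _, ?_⟩
      rw [hb]
      simp [logLossBits, ha]
    rw [this]
    exact le_top

/-- If `κ` is the conditional law of the state given the observation, then `κ` is a Bayes-optimal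
predictor. -/
lemma bayesLogLoss_eq_of_posterior {O : Type*} [MeasurableSpace O] (ρ : Measure (A × O))
    (κ : Kernel O A) [IsMarkovKernel κ]
    (hκ : ∀ a, ∀ c : O → ℝ≥0∞, Measurable c →
      ∫⁻ x, Set.indicator {a} 1 x.1 * c x.2 ∂ρ = ∫⁻ x, κ x.2 {a} * c x.2 ∂ρ) :
    bayesLogLoss ρ = ∫⁻ x, logLossBits (κ x.2 {x.1}) ∂ρ := by
  -- Conditioning turns the loss of any predictor into an average cross-entropy against `κ`, to
  -- which Gibbs' inequality applies at each observation.
  have key : ∀ q : Kernel O A, IsMarkovKernel q →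
      ∫⁻ x, logLossBits (q x.2 {x.1}) ∂ρ
        = ∫⁻ x, (∫⁻ a, logLossBits (q x.2 {a}) ∂(κ x.2)) ∂ρ := by
    intro q hq
    have hm : ∀ a, Measurable fun o => logLossBits (q o {a}) := fun a =>
      measurable_logLossBits.comp (q.measurable_coe (measurableSet_singleton a))
    have e1 : ∀ x : A × O, logLossBits (q x.2 {x.1})
        = ∑ a, Set.indicator {a} 1 x.1 * logLossBits (q x.2 {a}) := by
      intro x
      rw [Finset.sum_eq_single x.1]
      · simp
      · intro b _ hb; simp [hb.symm]
      · simp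
    simp_rw [e1, lintegral_fintype]
    have hi : ∀ a : A, Measurable fun x : A × O => Set.indicator ({a} : Set A) (1 : A → ℝ≥0∞) x.1 :=
      fun a => (measurable_one.indicator (measurableSet_singleton a)).comp measurable_fst
    have hk : ∀ a : A, Measurable fun x : A × O => κ x.2 {a} :=
      fun a => (κ.measurable_coe (measurableSet_singleton a)).comp measurable_snd
    have hm' : ∀ a, Measurable fun x : A × O => logLossBits (q x.2 {a}) :=
      fun a => (hm a).comp measurable_snd
    rw [lintegral_finsetSum Finset.univ
        (f := fun a (x : A × O) => Set.indicator ({a} : Set A) 1 x.1 * logLossBits (q x.2 {a}))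
        fun a _ => (hi a).mul (hm' a),
      lintegral_finsetSum Finset.univ
        (f := fun a (x : A × O) => logLossBits (q x.2 {a}) * κ x.2 {a})
        fun a _ => (hm' a).mul (hk a)]
    refine Finset.sum_congr rfl fun a _ => ?_
    rw [hκ a _ (hm a)]
    simp_rw [mul_comm]
  refine le_antisymm (iInf_le_of_le ⟨κ, inferInstance⟩ le_rfl) (le_iInf fun q => ?_)
  have := q.2
  rw [key κ inferInstance, key q.1 q.2]
  exact lintegral_mono fun x => lintegral_logLossBits_self_le _ _

end Finite

end Haystack

/-! ### Disintegration and the posterior of a single record -/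

namespace Haystack

/-- Disintegration of a joint law along its second coordinate. -/
lemma lintegral_eq_lintegral_condDistrib {A B : Type*} [MeasurableSpace A] [StandardBorelSpace A]
    [Nonempty A] [MeasurableSpace B] {ρ : Measure (A × B)} [IsFiniteMeasure ρ]
    {φ : A × B → ℝ≥0∞} (hφ : Measurable φ) :
    ∫⁻ x, φ x ∂ρ = ∫⁻ b, (∫⁻ a, φ (a, b) ∂condDistrib Prod.fst Prod.snd ρ b) ∂ρ.snd := by
  have h : (ρ.map Prod.snd) ⊗ₘ condDistrib Prod.fst Prod.snd ρ = ρ.map fun a => (a.2, a.1) :=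
    compProd_map_condDistrib measurable_fst.aemeasurable
  have e : ρ = (ρ.map (fun a => (a.2, a.1))).map Prod.swap := by
    rw [Measure.map_map (by fun_prop) (by fun_prop)]
    simp [Function.comp_def]
  have e2 : ∫⁻ x, φ x ∂ρ = ∫⁻ y, φ y.swap ∂(ρ.map fun a => (a.2, a.1)) := by
    conv_lhs => rw [e]
    rw [lintegral_map hφ (by fun_prop)]
  rw [e2, ← h, Measure.lintegral_compProd (by fun_prop)]
  rfl

section Score

variable {𝒵 : Type*} [MeasurableSpace 𝒵] (R : Measure (Bool × 𝒵)) [IsProbabilityMeasure R]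

lemma measurable_bayesScore : Measurable (bayesScore R) :=
  (Kernel.measurable_coe _ (measurableSet_singleton true)).ennreal_toReal

lemma bayesScore_nonneg (z : 𝒵) : 0 ≤ bayesScore R z := measureReal_nonneg

lemma bayesScore_le_one (z : 𝒵) : bayesScore R z ≤ 1 := measureReal_le_one

/-- Integrals against the law of `(T, Z)` are computed from the Bayes score. -/
lemma lintegral_eq_lintegral_bayesScore {φ : Bool × 𝒵 → ℝ≥0∞} (hφ : Measurable φ) :
    ∫⁻ x, φ x ∂(R) = ∫⁻ z, (φ (true, z) * ENNReal.ofReal (bayesScore R z)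
      + φ (false, z) * ENNReal.ofReal (1 - bayesScore R z)) ∂(R.snd) := by
  rw [lintegral_eq_lintegral_condDistrib hφ]
  refine lintegral_congr fun z => ?_
  rw [lintegral_fintype]
  have hf : condDistrib (Prod.fst : Bool × 𝒵 → Bool) Prod.snd R z {false}
      = ENNReal.ofReal (1 - bayesScore R z) := by
    have h1 := sum_univ_measureReal_singleton (condDistrib (Prod.fst : Bool × 𝒵 → Bool) Prod.snd R z)
    simp only [Fintype.sum_bool] at h1
    rw [bayesScore, ← h1, add_sub_cancel_left, ofReal_measureReal]
  simp [hf, bayesScore, ofReal_measureReal]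

end Score

section Posterior

variable {𝒯 𝒵 𝒱 : Type*} [Fintype 𝒯] [Nonempty 𝒯] [MeasurableSpace 𝒯]
  [MeasurableSingletonClass 𝒯] [MeasurableSpace 𝒵] [MeasurableSpace 𝒱]
  (prior : Measure 𝒯) [IsProbabilityMeasure prior] (W : Kernel (𝒯 × Bool) 𝒱) [IsMarkovKernel W]

instance (t : Bool) : IsProbabilityMeasure (stateOutputLaw prior W t) := by
  unfold stateOutputLaw; infer_instance

instance (R : Measure (Bool × 𝒵)) [IsProbabilityMeasure R] :
    IsProbabilityMeasure (recordLaw prior R W) := by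
  unfold recordLaw; infer_instance

instance (R : Measure (Bool × 𝒵)) [IsProbabilityMeasure R] (K : ℕ) :
    IsProbabilityMeasure (recordsLaw prior R W K) := by
  unfold recordsLaw; infer_instance

lemma fst_stateOutputLaw (t : Bool) : (stateOutputLaw prior W t).fst = prior := by
  simp [stateOutputLaw]

/-- The conditional law of the state given the output of an informative verification. -/
def informativePosterior : Kernel 𝒱 𝒯 :=
  condDistrib Prod.fst Prod.snd (stateOutputLaw prior W true)

instance : IsMarkovKernel (informativePosterior prior W) := by
  unfold informativePosterior; infer_instance

/-- Integrals against the joint law of state and informative output, by conditioning on the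
output. -/
lemma lintegral_stateOutputLaw_true {φ : 𝒯 × 𝒱 → ℝ≥0∞} (hφ : Measurable φ) :
    ∫⁻ x, φ x ∂stateOutputLaw prior W true
      = ∫⁻ v, (∫⁻ θ, φ (θ, v) ∂informativePosterior prior W v)
          ∂(stateOutputLaw prior W true).snd :=
  lintegral_eq_lintegral_condDistrib hφ

lemma lintegral_indicator_stateOutputLaw_true (a : 𝒯) {c : 𝒱 → ℝ≥0∞} (hc : Measurable c) :
    ∫⁻ x, Set.indicator {a} 1 x.1 * c x.2 ∂stateOutputLaw prior W true
      = ∫⁻ x, informativePosterior prior W x.2 {a} * c x.2 ∂stateOutputLaw prior W true := by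
  have hi : Measurable (Set.indicator ({a} : Set 𝒯) (1 : 𝒯 → ℝ≥0∞)) :=
    measurable_one.indicator (measurableSet_singleton a)
  have hk : Measurable fun v => informativePosterior prior W v {a} :=
    Kernel.measurable_coe _ (measurableSet_singleton a)
  rw [lintegral_stateOutputLaw_true _ _ (by fun_prop),
    lintegral_stateOutputLaw_true _ _ (by fun_prop)]
  refine lintegral_congr fun v => ?_
  dsimp only
  rw [lintegral_mul_const _ hi, lintegral_indicator_one (measurableSet_singleton a),
    lintegral_const]
  simp

lemma lintegral_indicator_stateOutputLaw_false
    (hW : IndepFun Prod.fst Prod.snd (stateOutputLaw prior W false))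
    (a : 𝒯) {c : 𝒱 → ℝ≥0∞} (hc : Measurable c) :
    ∫⁻ x, Set.indicator {a} 1 x.1 * c x.2 ∂stateOutputLaw prior W false
      = ∫⁻ x, prior {a} * c x.2 ∂stateOutputLaw prior W false := by
  have hi : Measurable (Set.indicator ({a} : Set 𝒯) (1 : 𝒯 → ℝ≥0∞)) :=
    measurable_one.indicator (measurableSet_singleton a)
  have h := lintegral_mul_eq_lintegral_mul_lintegral_of_indepFun''
    (μ := stateOutputLaw prior W false) (f := fun x => Set.indicator {a} 1 x.1)
    (g := fun x => c x.2) (hi.comp measurable_fst).aemeasurable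
    (hc.comp measurable_snd).aemeasurable (hW.comp hi hc)
  have h2 : ∫⁻ x, Set.indicator {a} (1 : 𝒯 → ℝ≥0∞) x.1 ∂stateOutputLaw prior W false
      = prior {a} := by
    rw [← lintegral_map (μ := stateOutputLaw prior W false) (g := Prod.fst) hi measurable_fst]
    change ∫⁻ x, _ ∂(stateOutputLaw prior W false).fst = _
    rw [fst_stateOutputLaw, lintegral_indicator_one (measurableSet_singleton a)]
  rw [h2] at h
  rw [h, lintegral_const_mul _ (by fun_prop)]

/-- The posterior of the state of a record given its transcript. -/
def recordPosterior : Kernel (Unit ⊕ (Bool × 𝒱)) 𝒯 where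
  toFun := Sum.elim (fun _ => prior)
    (fun y => if y.1 = true then informativePosterior prior W y.2 else prior)
  measurable' := by
    refine measurable_const.sumElim (Measurable.ite ?_ ?_ measurable_const)
    · exact measurable_fst (measurableSet_singleton true)
    · exact (informativePosterior prior W).measurable.comp measurable_snd

instance : IsMarkovKernel (recordPosterior prior W) where
  isProbabilityMeasure y := by
    rcases y with _ | ⟨t, v⟩
    · exact inferInstanceAs (IsProbabilityMeasure prior)
    · cases t
      · exact inferInstanceAs (IsProbabilityMeasure prior)
      · exact inferInstanceAs (IsProbabilityMeasure (informativePosterior prior W v))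

@[simp] lemma recordPosterior_inl : recordPosterior prior W (Sum.inl ()) = prior := rfl

@[simp] lemma recordPosterior_false (v : 𝒱) :
    recordPosterior prior W (Sum.inr (false, v)) = prior := rfl

@[simp] lemma recordPosterior_true (v : 𝒱) :
    recordPosterior prior W (Sum.inr (true, v)) = informativePosterior prior W v := rfl

/-- The transcript of one record, verified or not according to `s`. -/
def recordTranscript (s : Bool) (x : (𝒯 × (Bool × 𝒵)) × 𝒱) : Unit ⊕ (Bool × 𝒱) :=
  if s = true then Sum.inr (x.1.2.1, x.2) else Sum.inl ()

lemma measurable_recordTranscript (s : Bool) :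
    Measurable (recordTranscript s : (𝒯 × (Bool × 𝒵)) × 𝒱 → _) := by
  cases s
  · exact measurable_const
  · exact measurable_inr.comp (by fun_prop)

variable (R : Measure (Bool × 𝒵)) [IsProbabilityMeasure R]

/-- Integrating over the type and statistic last fixes the type inside, so the informative and
uninformative cases can be treated separately. -/
lemma lintegral_recordLaw {φ : (𝒯 × (Bool × 𝒵)) × 𝒱 → ℝ≥0∞} (hφ : Measurable φ) :
    ∫⁻ x, φ x ∂recordLaw prior R W
      = ∫⁻ r, (∫⁻ y, φ ((y.1, r), y.2) ∂stateOutputLaw prior W r.1) ∂(R) := by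
  rw [recordLaw, Measure.lintegral_compProd hφ, lintegral_prod_symm]
  · refine lintegral_congr fun r => ?_
    rw [stateOutputLaw, Measure.lintegral_compProd (by fun_prop)]
    rfl
  · exact (Measurable.lintegral_kernel_prod_right' hφ).aemeasurable

/-- Given the type and statistic there are three cases: an unverified record reveals nothing, type 0
has output independent of the state by `hW`, and type 1 is the defining property of the informative
posterior. The verification decision `s` can be held fixed because selection sees only screening
statistics. -/
lemma lintegral_recordPosterior (hW : IndepFun Prod.fst Prod.snd (stateOutputLaw prior W false))
    (s : Bool) (a : 𝒯) {c : 𝒵 × (Unit ⊕ (Bool × 𝒱)) → ℝ≥0∞} (hc : Measurable c) :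
    ∫⁻ x, Set.indicator {a} 1 x.1.1 * c (x.1.2.2, recordTranscript s x) ∂recordLaw prior R W
      = ∫⁻ x, recordPosterior prior W (recordTranscript s x) {a}
          * c (x.1.2.2, recordTranscript s x) ∂recordLaw prior R W := by
  have hi : Measurable (Set.indicator ({a} : Set 𝒯) (1 : 𝒯 → ℝ≥0∞)) :=
    measurable_one.indicator (measurableSet_singleton a)
  have hk : Measurable fun y => recordPosterior prior W y {a} :=
    Kernel.measurable_coe _ (measurableSet_singleton a)
  have ht := measurable_recordTranscript (𝒯 := 𝒯) (𝒵 := 𝒵) (𝒱 := 𝒱) s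
  rw [lintegral_recordLaw _ _ _ (by fun_prop), lintegral_recordLaw _ _ _ (by fun_prop)]
  refine lintegral_congr fun r => ?_
  obtain ⟨t, z⟩ := r
  cases s
  · simp only [recordTranscript, Bool.false_eq_true, if_false, recordPosterior_inl]
    rw [lintegral_mul_const _ (by fun_prop), lintegral_const]
    have : ∫⁻ y, Set.indicator {a} (1 : 𝒯 → ℝ≥0∞) y.1 ∂stateOutputLaw prior W t
        = prior {a} := by
      rw [← lintegral_map (μ := stateOutputLaw prior W t) (g := Prod.fst) hi measurable_fst]
      change ∫⁻ x, _ ∂(stateOutputLaw prior W t).fst = _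
      rw [fst_stateOutputLaw, lintegral_indicator_one (measurableSet_singleton a)]
    rw [this]; simp
  · have hc' : ∀ t, Measurable fun v => c (z, Sum.inr (t, v)) := fun t =>
      hc.comp (measurable_const.prodMk (measurable_inr.comp (by fun_prop)))
    simp only [recordTranscript, if_true]
    cases t
    · simpa using lintegral_indicator_stateOutputLaw_false prior W hW a (hc' false)
    · simpa using lintegral_indicator_stateOutputLaw_true prior W a (hc' true)

/-- Expected log-loss of the posterior predictor on one record. -/
lemma lintegral_logLossBits_recordPosterior {I : ℝ} (hI0 : 0 ≤ I) (hIH : I ≤ entropyBits prior)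
    (hI : ∫⁻ y, logLossBits (informativePosterior prior W y.2 {y.1}) ∂stateOutputLaw prior W true
      = ENNReal.ofReal (entropyBits prior - I))
    (s : Bool) {c : 𝒵 → ℝ≥0∞} (hc : Measurable c) :
    ∫⁻ x, logLossBits (recordPosterior prior W (recordTranscript s x) {x.1.1}) * c x.1.2.2
        ∂recordLaw prior R W
      = ∫⁻ x, ENNReal.ofReal (entropyBits prior - if s = true then I * bayesScore R x.1.2.2 else 0)
          * c x.1.2.2 ∂recordLaw prior R W := by
  have hL : Measurable fun x : (𝒯 × (Bool × 𝒵)) × 𝒱 =>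
      logLossBits (recordPosterior prior W (recordTranscript s x) {x.1.1}) := by
    refine measurable_logLossBits.comp ?_
    have h1 : Measurable fun u : (Unit ⊕ (Bool × 𝒱)) × 𝒯 => recordPosterior prior W u.1 {u.2} := by
      refine measurable_from_prod_countable_left fun θ => ?_
      exact Kernel.measurable_coe _ (measurableSet_singleton θ)
    exact h1.comp ((measurable_recordTranscript s).prodMk (by fun_prop))
  have hη := measurable_bayesScore R
  -- Given the type, the loss drops by `I` exactly when the record is both verified and informative.
  have hw : ∀ r : Bool × 𝒵, ∫⁻ y, logLossBits (recordPosterior prior W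
        (recordTranscript s ((y.1, r), y.2)) {y.1}) * c r.2 ∂stateOutputLaw prior W r.1
      = ENNReal.ofReal (entropyBits prior - if (s && r.1) = true then I else 0) * c r.2 := by
    rintro ⟨t, z⟩
    have hg : Measurable fun y : 𝒯 × 𝒱 => ((y.1, (t, z)), y.2) := by fun_prop
    have hLg : Measurable fun y : 𝒯 × 𝒱 => logLossBits (recordPosterior prior W
        (recordTranscript s ((y.1, (t, z)), y.2)) {y.1}) := hL.comp hg
    rw [lintegral_mul_const _ hLg]
    congr 1
    have hprior : ∫⁻ y, logLossBits (prior {y.1}) ∂stateOutputLaw prior W t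
        = ENNReal.ofReal (entropyBits prior) := by
      rw [← lintegral_logLossBits_self, ← lintegral_map (μ := stateOutputLaw prior W t)
        (f := fun a => logLossBits (prior {a})) (g := Prod.fst) (measurable_of_countable _)
        measurable_fst]
      change ∫⁻ x, _ ∂(stateOutputLaw prior W t).fst = _
      rw [fst_stateOutputLaw]
    cases s
    · simpa [recordTranscript] using hprior
    · cases t
      · simpa [recordTranscript] using hprior
      · simpa [recordTranscript] using hI
  rw [lintegral_recordLaw _ _ _ (by fun_prop), lintegral_recordLaw _ _ _ ?_]
  · simp_rw [hw]
    simp only [lintegral_const, measure_univ, mul_one]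
    have hm1 : Measurable fun r : Bool × 𝒵 =>
        ENNReal.ofReal (entropyBits prior - if (s && r.1) = true then I else 0) * c r.2 := by
      refine Measurable.mul ?_ (by fun_prop)
      exact (measurable_of_countable (fun t : Bool => ENNReal.ofReal
        (entropyBits prior - if (s && t) = true then I else 0))).comp measurable_fst
    have hm2 : Measurable fun r : Bool × 𝒵 =>
        ENNReal.ofReal (entropyBits prior - if s = true then I * bayesScore R r.2 else 0)
          * c r.2 := by
      cases s <;> simp <;> fun_prop
    -- Averaging over the type given the statistic replaces the indicator of type 1 by the Bayes
    -- score.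
    rw [lintegral_eq_lintegral_bayesScore R hm1, lintegral_eq_lintegral_bayesScore R hm2]
    refine lintegral_congr fun z => ?_
    have h0 := bayesScore_nonneg R z
    have h1 := bayesScore_le_one R z
    cases s
    · simp
    · simp only [Bool.true_and, if_true, Bool.false_eq_true, if_false, sub_zero]
      have e : ∀ u v w : ℝ≥0∞, u * c z * v = u * v * c z := fun u v w => by ring
      rw [mul_right_comm, mul_right_comm _ (c z), ← add_mul, mul_right_comm _ (c z),
        mul_right_comm _ (c z), ← add_mul, ← mul_add, ← ENNReal.ofReal_add h0 (by linarith),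
        ← ENNReal.ofReal_mul (by linarith), ← ENNReal.ofReal_mul (by linarith),
        ← ENNReal.ofReal_add (by nlinarith) (by nlinarith)]
      simp only [add_sub_cancel, ENNReal.ofReal_one, mul_one]
      congr 2
      ring
  · cases s <;> simp <;> fun_prop

end Posterior

end Haystack

/-! ### Product posterior and reduction of the gain to expected hits -/

namespace Haystack

variable {𝒯 𝒵 𝒱 : Type*} [Fintype 𝒯] [Nonempty 𝒯] [MeasurableSpace 𝒯]
  [MeasurableSingletonClass 𝒯] [MeasurableSpace 𝒵] [MeasurableSpace 𝒱]
  (prior : Measure 𝒯) [IsProbabilityMeasure prior] (W : Kernel (𝒯 × Bool) 𝒱) [IsMarkovKernel W]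
  {K B : ℕ}

/-- The posterior of all states given the observation: the product of the record posteriors. -/
def jointPosterior (K : ℕ) :
    Kernel ((Fin K → 𝒵) × (Fin K → Unit ⊕ (Bool × 𝒱))) (Fin K → 𝒯) where
  toFun o := Measure.pi fun i => recordPosterior prior W (o.2 i)
  measurable' := by
    classical
    refine Measure.measurable_of_measurable_coe _ fun s _ => ?_
    have h : ∀ o : (Fin K → 𝒵) × (Fin K → Unit ⊕ (Bool × 𝒱)),
        Measure.pi (fun i => recordPosterior prior W (o.2 i)) s
          = ∑ a ∈ s.toFinite.toFinset, ∏ i, recordPosterior prior W (o.2 i) {a i} := by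
      intro o
      simp_rw [← Measure.pi_singleton (fun i => recordPosterior prior W (o.2 i))]
      rw [sum_measure_singleton]
      simp
    simp_rw [h]
    refine Finset.measurable_sum _ fun a _ => Finset.measurable_prod _ fun i _ => ?_
    exact (Kernel.measurable_coe (recordPosterior prior W)
      (measurableSet_singleton (a i))).comp (by fun_prop)

lemma jointPosterior_apply_singleton (o : (Fin K → 𝒵) × (Fin K → Unit ⊕ (Bool × 𝒱)))
    (a : Fin K → 𝒯) :
    jointPosterior prior W K o {a} = ∏ i, recordPosterior prior W (o.2 i) {a i} :=
  Measure.pi_singleton _ _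

instance : IsMarkovKernel (jointPosterior prior W K :
    Kernel ((Fin K → 𝒵) × (Fin K → Unit ⊕ (Bool × 𝒱))) (Fin K → 𝒯)) where
  isProbabilityMeasure o :=
    inferInstanceAs (IsProbabilityMeasure (Measure.pi fun i => recordPosterior prior W (o.2 i)))

lemma transcript_eq_recordTranscript (x : Fin K → (𝒯 × (Bool × 𝒵)) × 𝒱) (S : Fin K → Bool)
    (i : Fin K) : transcript x S i = recordTranscript (S i) (x i) := rfl

lemma measurable_transcript (S : Fin K → Bool) :
    Measurable fun x : Fin K → (𝒯 × (Bool × 𝒵)) × 𝒱 => transcript x S :=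
  measurable_pi_iff.2 fun i => (measurable_recordTranscript (S i)).comp (measurable_pi_apply i)

variable (R : Measure (Bool × 𝒵)) [IsProbabilityMeasure R] (P : Policy 𝒵 K B)

/-- There are finitely many possible selections, so the private randomness becomes a finite mixture
in which `S` is fixed and weighted by a function of the statistics alone. -/
lemma lintegral_outcomeLaw
    {h : (Fin K → 𝒯) × ((Fin K → 𝒵) × (Fin K → Unit ⊕ (Bool × 𝒱))) → ℝ≥0∞} (hh : Measurable h) :
    ∫⁻ w, h w ∂outcomeLaw prior R W P
      = ∑ S : Fin K → Bool, ∫⁻ x, h (fun i => (x i).1.1, (fun i => (x i).1.2.2, transcript x S))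
          * P.select (fun i => (x i).1.2.2) {S} ∂recordsLaw prior R W K := by
  have := P.isMarkov
  have ht : Measurable fun w : (Fin K → (𝒯 × (Bool × 𝒵)) × 𝒱) × (Fin K → Bool) =>
      transcript w.1 w.2 := by
    refine measurable_from_prod_countable_left fun S => measurable_transcript S
  have hm : Measurable fun w : (Fin K → (𝒯 × (Bool × 𝒵)) × 𝒱) × (Fin K → Bool) =>
      ((fun i => (w.1 i).1.1, (fun i => (w.1 i).1.2.2, transcript w.1 w.2)) :
        (Fin K → 𝒯) × ((Fin K → 𝒵) × (Fin K → Unit ⊕ (Bool × 𝒱)))) :=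
    Measurable.prodMk (by fun_prop) (Measurable.prodMk (by fun_prop) ht)
  have hhm : Measurable fun w : (Fin K → (𝒯 × (Bool × 𝒵)) × 𝒱) × (Fin K → Bool) =>
      h (fun i => (w.1 i).1.1, (fun i => (w.1 i).1.2.2, transcript w.1 w.2)) := hh.comp hm
  rw [outcomeLaw, lintegral_map hh hm, Measure.lintegral_compProd hhm]
  simp_rw [lintegral_fintype]
  rw [lintegral_finsetSum]
  · rfl
  · intro S _
    refine Measurable.mul ?_ ?_
    · exact hhm.comp (measurable_id.prodMk measurable_const)
    · exact Kernel.measurable_coe _ (measurableSet_singleton S)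

lemma measurable_select_statistics (S : Fin K → Bool) :
    Measurable fun z : Fin K → 𝒵 => P.select z {S} :=
  Kernel.measurable_coe _ (measurableSet_singleton S)

/-- The product posterior is the conditional law of the states given the observation. -/
lemma lintegral_jointPosterior (hW : IndepFun Prod.fst Prod.snd (stateOutputLaw prior W false))
    (a : Fin K → 𝒯) {c : (Fin K → 𝒵) × (Fin K → Unit ⊕ (Bool × 𝒱)) → ℝ≥0∞} (hc : Measurable c) :
    ∫⁻ w, Set.indicator {a} 1 w.1 * c w.2 ∂outcomeLaw prior R W P
      = ∫⁻ w, jointPosterior prior W K w.2 {a} * c w.2 ∂outcomeLaw prior R W P := by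
  have hi : Measurable (Set.indicator ({a} : Set (Fin K → 𝒯)) (1 : (Fin K → 𝒯) → ℝ≥0∞)) :=
    measurable_one.indicator (measurableSet_singleton a)
  have hk : Measurable fun o => (jointPosterior prior W K :
      Kernel ((Fin K → 𝒵) × (Fin K → Unit ⊕ (Bool × 𝒱))) (Fin K → 𝒯)) o {a} :=
    Kernel.measurable_coe _ (measurableSet_singleton a)
  rw [lintegral_outcomeLaw _ _ _ _ (by fun_prop), lintegral_outcomeLaw _ _ _ _ (by fun_prop)]
  refine Finset.sum_congr rfl fun S _ => ?_
  have hP := measurable_select_statistics P S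
  -- The selection probability is a function of the observed statistics, so it is absorbed into `H`
  -- and does not bias the posterior.
  have key := lintegral_pi_prod_mul_congr (δ := Fin K) (μ := recordLaw prior R W)
    (a := fun i x => Set.indicator {a i} 1 x.1.1)
    (b := fun i x => recordPosterior prior W (recordTranscript (S i) x) {a i})
    (o := fun i x => (x.1.2.2, recordTranscript (S i) x))
    (fun i => (measurable_one.indicator (measurableSet_singleton (a i))).comp (by fun_prop))
    (fun i => (Kernel.measurable_coe _ (measurableSet_singleton (a i))).comp
      (measurable_recordTranscript (S i)))
    (fun i => Measurable.prodMk (by fun_prop) (measurable_recordTranscript (S i)))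
    (fun i c hc => lintegral_recordPosterior prior W R hW (S i) (a i) hc)
    (H := fun o => c (fun i => (o i).1, fun i => (o i).2) * P.select (fun i => (o i).1) {S})
    (by fun_prop)
  simp_rw [jointPosterior_apply_singleton, transcript_eq_recordTranscript]
  have e : ∀ x : Fin K → (𝒯 × (Bool × 𝒵)) × 𝒱,
      Set.indicator {a} (1 : (Fin K → 𝒯) → ℝ≥0∞) (fun i => (x i).1.1)
        = ∏ i, Set.indicator {a i} 1 (x i).1.1 := by
    intro x
    by_cases h : (fun i => (x i).1.1) = a
    · subst h; simp
    · rw [Set.indicator_of_notMem (by simpa using h)]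
      obtain ⟨i, hi⟩ := Function.ne_iff.1 h
      exact (Finset.prod_eq_zero (Finset.mem_univ i) (by simp [hi])).symm
  simp_rw [e, mul_assoc]
  exact key

/-- The optimal log-loss for the observation generated by a policy. -/
lemma bayesLogLoss_outcomeLaw (hW : IndepFun Prod.fst Prod.snd (stateOutputLaw prior W false)) :
    bayesLogLoss (outcomeLaw prior R W P)
      = ∑ S : Fin K → Bool, ∑ i, ∫⁻ x,
          logLossBits (recordPosterior prior W (recordTranscript (S i) (x i)) {(x i).1.1})
            * P.select (fun i => (x i).1.2.2) {S} ∂recordsLaw prior R W K := by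
  rw [bayesLogLoss_eq_of_posterior _ (jointPosterior prior W K)
    fun a c hc => lintegral_jointPosterior prior W R P hW a hc, lintegral_outcomeLaw]
  · refine Finset.sum_congr rfl fun S _ => ?_
    rw [← lintegral_finsetSum]
    · refine lintegral_congr fun x => ?_
      rw [jointPosterior_apply_singleton, logLossBits_prod _ _ fun i => prob_le_one,
        Finset.sum_mul]
      rfl
    · intro i _
      refine Measurable.mul ?_ ((measurable_select_statistics P S).comp (by fun_prop))
      refine measurable_logLossBits.comp ?_
      have h1 : Measurable fun u : (Unit ⊕ (Bool × 𝒱)) × 𝒯 => recordPosterior prior W u.1 {u.2} :=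
        measurable_from_prod_countable_left fun θ =>
          Kernel.measurable_coe _ (measurableSet_singleton θ)
      exact h1.comp (((measurable_recordTranscript (S i)).comp (measurable_pi_apply i)).prodMk
        (by fun_prop))
  · refine measurable_logLossBits.comp ?_
    have h1 : Measurable fun u : ((Fin K → 𝒵) × (Fin K → Unit ⊕ (Bool × 𝒱))) × (Fin K → 𝒯) =>
        jointPosterior prior W K u.1 {u.2} :=
      measurable_from_prod_countable_left fun θ =>
        Kernel.measurable_coe _ (measurableSet_singleton θ)
    exact h1.comp measurable_swap

/-- The expected number of informative records that a policy verifies. -/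
def expectedHits : ℝ :=
  ∫ z, ∑ i, (P.select z).real {S | S i = true} * bayesScore R (z i) ∂Measure.pi fun _ => R.snd

lemma measurable_select_real (i : Fin K) :
    Measurable fun z : Fin K → 𝒵 => (P.select z).real {S | S i = true} :=
  (Kernel.measurable_coe _ (Set.toFinite _).measurableSet).ennreal_toReal

lemma integrable_hits (i : Fin K) :
    Integrable (fun z : Fin K → 𝒵 => (P.select z).real {S | S i = true} * bayesScore R (z i))
      (Measure.pi fun _ => R.snd) := by
  have := P.isMarkov
  have h1 := measurable_select_real P i
  have h2 := measurable_bayesScore R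
  refine Integrable.of_bound (by fun_prop) 1 (ae_of_all _ fun z => ?_)
  rw [Real.norm_of_nonneg (mul_nonneg measureReal_nonneg (bayesScore_nonneg R _))]
  exact mul_le_one₀ measureReal_le_one (bayesScore_nonneg R _) (bayesScore_le_one R _)

/-- With `I` at most the prior entropy, this keeps the optimal loss `K H - I * hits` nonnegative, so
it survives the passage through `ENNReal.ofReal`. -/
lemma expectedHits_le : expectedHits R P ≤ K := by
  have := P.isMarkov
  have h : expectedHits R P ≤ ∫ z, (K : ℝ) ∂Measure.pi fun _ : Fin K => R.snd := by
    refine integral_mono (integrable_finsetSum _ fun i _ => integrable_hits R P i)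
      (integrable_const _) fun z => ?_
    calc _ ≤ ∑ i : Fin K, (1 : ℝ) := Finset.sum_le_sum fun i _ =>
          mul_le_one₀ measureReal_le_one (bayesScore_nonneg R _) (bayesScore_le_one R _)
      _ = K := by simp
  simpa using h

/-- The optimal log-loss of a policy is the prior entropy minus the verification information times
the expected number of informative records verified. -/
lemma bayesLogLoss_outcomeLaw_eq
    (hW : IndepFun Prod.fst Prod.snd (stateOutputLaw prior W false))
    {I : ℝ} (hI0 : 0 ≤ I) (hIH : I ≤ entropyBits prior)
    (hI : ∫⁻ y, logLossBits (informativePosterior prior W y.2 {y.1}) ∂stateOutputLaw prior W true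
      = ENNReal.ofReal (entropyBits prior - I)) :
    bayesLogLoss (outcomeLaw prior R W P)
      = ENNReal.ofReal (K * entropyBits prior - I * expectedHits R P) := by
  have := P.isMarkov
  have hη := measurable_bayesScore R
  set H := entropyBits prior
  have hnn : ∀ (s : Bool) (z : 𝒵), 0 ≤ H - if s = true then I * bayesScore R z else 0 := by
    intro s z
    have h0 := bayesScore_nonneg R z
    have h1 := bayesScore_le_one R z
    split_ifs <;> nlinarith
  have hLm : ∀ s : Bool, Measurable fun x : (𝒯 × (Bool × 𝒵)) × 𝒱 =>
      logLossBits (recordPosterior prior W (recordTranscript s x) {x.1.1}) := by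
    intro s
    refine measurable_logLossBits.comp ?_
    have h1 : Measurable fun u : (Unit ⊕ (Bool × 𝒱)) × 𝒯 => recordPosterior prior W u.1 {u.2} :=
      measurable_from_prod_countable_left fun θ =>
        Kernel.measurable_coe _ (measurableSet_singleton θ)
    exact h1.comp ((measurable_recordTranscript s).prodMk (by fun_prop))
  have hwm : ∀ s : Bool, Measurable fun z : 𝒵 =>
      ENNReal.ofReal (H - if s = true then I * bayesScore R z else 0) := by
    intro s
    cases s
    · simp
    · simp; fun_prop
  -- Only coordinate `i` carries a loss. With the other coordinates frozen, the selection
  -- probability is a function of the `i`-th statistic, as the one-record identity requires of `c`.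
  have swap : ∀ (S : Fin K → Bool) (i : Fin K), ∫⁻ x,
        logLossBits (recordPosterior prior W (recordTranscript (S i) (x i)) {(x i).1.1})
          * P.select (fun i => (x i).1.2.2) {S} ∂recordsLaw prior R W K
      = ∫⁻ z, ENNReal.ofReal (H - if S i = true then I * bayesScore R (z i) else 0)
          * P.select z {S} ∂Measure.pi fun _ => R.snd := by
    intro S i
    have hP := measurable_select_statistics P S
    have hz : Measurable fun x : (𝒯 × (Bool × 𝒵)) × 𝒱 => x.1.2.2 := by fun_prop
    have hmap : (recordsLaw prior R W K).map (fun x i => (x i).1.2.2)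
        = Measure.pi fun _ => R.snd := by
      have h1 : (recordLaw prior R W).map (fun x => x.1.2.2) = R.snd := by
        have : (recordLaw prior R W).map (fun x => x.1.2.2)
            = ((recordLaw prior R W).fst.snd).snd := by
          rw [Measure.snd, Measure.snd, Measure.fst, Measure.map_map (by fun_prop) (by fun_prop),
            Measure.map_map (by fun_prop) (by fun_prop)]
          rfl
        rw [this, recordLaw, Measure.fst_compProd, Measure.snd_prod]
      have := Measure.pi_map_pi (μ := fun _ : Fin K => recordLaw prior R W)
        (f := fun _ x => x.1.2.2) (fun _ => hz.aemeasurable)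
      rw [recordsLaw, this]
      simp_rw [h1]
    have hwP : Measurable fun z : Fin K → 𝒵 =>
        ENNReal.ofReal (H - if S i = true then I * bayesScore R (z i) else 0) * P.select z {S} :=
      ((hwm (S i)).comp (measurable_pi_apply i)).mul hP
    rw [← hmap, lintegral_map hwP (by fun_prop)]
    have hL := (hLm (S i)).comp (measurable_pi_apply (X := fun _ : Fin K => _) i)
    have hw := ((hwm (S i)).comp hz).comp (measurable_pi_apply (X := fun _ : Fin K => _) i)
    refine lintegral_pi_congr_update i (hL.mul (hP.comp (by fun_prop)))
      (hw.mul (hP.comp (by fun_prop))) fun x => ?_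
    have e : ∀ y : (𝒯 × (Bool × 𝒵)) × 𝒱, (fun j => (Function.update x i y j).1.2.2)
        = Function.update (fun j => (x j).1.2.2) i y.1.2.2 := by
      intro y
      funext j
      by_cases hj : j = i
      · subst hj; simp
      · simp [hj]
    simp_rw [e, Function.update_self]
    exact lintegral_logLossBits_recordPosterior prior W R hI0 hIH hI (S i)
      (c := fun z => P.select (Function.update (fun j => (x j).1.2.2) i z) {S}) (by fun_prop)
  rw [bayesLogLoss_outcomeLaw prior W R P hW]
  simp_rw [swap]
  have hms : ∀ (S : Fin K → Bool) (i : Fin K), Measurable fun z : Fin K → 𝒵 =>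
      ENNReal.ofReal (H - if S i = true then I * bayesScore R (z i) else 0) * P.select z {S} :=
    fun S i => ((hwm (S i)).comp (measurable_pi_apply i)).mul (measurable_select_statistics P S)
  simp_rw [← lintegral_finsetSum Finset.univ fun i _ => hms _ i]
  rw [← lintegral_finsetSum Finset.univ fun S _ => Finset.measurable_sum _ fun i _ => hms S i]
  -- Summation over `S` with the policy's probabilities turns each indicator of selection into the
  -- marginal probability of verifying record `i`.
  have pt : ∀ z : Fin K → 𝒵, ∑ S : Fin K → Bool, ∑ i,
      ENNReal.ofReal (H - if S i = true then I * bayesScore R (z i) else 0) * P.select z {S}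
      = ENNReal.ofReal
        (K * H - I * ∑ i, (P.select z).real {S | S i = true} * bayesScore R (z i)) := by
    intro z
    have e1 : ∀ (S : Fin K → Bool) (i : Fin K),
        ENNReal.ofReal (H - if S i = true then I * bayesScore R (z i) else 0) * P.select z {S}
        = ENNReal.ofReal ((H - if S i = true then I * bayesScore R (z i) else 0)
          * (P.select z).real {S}) := fun S i => by
      rw [ENNReal.ofReal_mul (hnn _ _), ofReal_measureReal]
    simp_rw [e1]
    rw [Finset.sum_comm]
    simp_rw [← ENNReal.ofReal_sum_of_nonneg
      fun (S : Fin K → Bool) (_ : S ∈ Finset.univ) => mul_nonneg (hnn (S _) (z _))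
        (measureReal_nonneg (μ := P.select z) (s := {S}))]
    rw [← ENNReal.ofReal_sum_of_nonneg fun i _ => Finset.sum_nonneg fun S _ =>
      mul_nonneg (hnn _ _) measureReal_nonneg]
    congr 1
    have e2 : ∀ i, ∑ S : Fin K → Bool, (H - if S i = true then I * bayesScore R (z i) else 0)
          * (P.select z).real {S}
        = H - I * ((P.select z).real {S | S i = true} * bayesScore R (z i)) := by
      intro i
      simp_rw [sub_mul]
      rw [Finset.sum_sub_distrib, ← Finset.mul_sum, sum_univ_measureReal_singleton, mul_one]
      congr 1
      have e3 : (P.select z).real {S | S i = true}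
          = ∑ S ∈ Finset.univ.filter (fun S : Fin K → Bool => S i = true),
            (P.select z).real {S} := by
        rw [MeasureTheory.sum_measureReal_singleton]
        congr 1
        ext; simp
      rw [e3, Finset.sum_filter, Finset.sum_mul, Finset.mul_sum]
      refine Finset.sum_congr rfl fun S _ => ?_
      split_ifs <;> ring
    simp_rw [e2]
    rw [Finset.sum_sub_distrib, ← Finset.mul_sum]
    simp
  simp_rw [pt]
  have hint := integrable_finsetSum Finset.univ fun i _ => integrable_hits R P i
  rw [← ofReal_integral_eq_lintegral_ofReal]
  · rw [integral_sub (integrable_const _) (hint.const_mul _), integral_const_mul I]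
    simp [expectedHits]
  · exact (integrable_const _).sub (hint.const_mul _)
  · refine ae_of_all _ fun z => ?_
    have : ∑ i : Fin K, (P.select z).real {S | S i = true} * bayesScore R (z i) ≤ K := by
      calc _ ≤ ∑ i : Fin K, (1 : ℝ) := Finset.sum_le_sum fun i _ =>
            mul_le_one₀ measureReal_le_one (bayesScore_nonneg R _) (bayesScore_le_one R _)
        _ = K := by simp
    have hK : (0 : ℝ) ≤ K := Nat.cast_nonneg K
    simp only [Pi.zero_apply]
    nlinarith [mul_le_mul_of_nonneg_left this hI0, mul_le_mul_of_nonneg_left hIH hK]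

/-- Entropy is additive over independent records. -/
lemma entropyBits_pi : entropyBits (Measure.pi fun _ : Fin K => prior) = K * entropyBits prior := by
  have hnn : ∀ {A : Type _} [Fintype A] [MeasurableSpace A] (μ : Measure A)
      [IsProbabilityMeasure μ], 0 ≤ entropyBits μ := fun μ _ =>
    Finset.sum_nonneg fun a _ => div_nonneg
      (Real.negMulLog_nonneg measureReal_nonneg measureReal_le_one) (Real.log_pos one_lt_two).le
  -- Entropy is the log-loss of the true law, so its additivity is inherited from that of log-loss
  -- on products.
  have h := lintegral_logLossBits_self (Measure.pi fun _ : Fin K => prior)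
  simp_rw [Measure.pi_singleton, logLossBits_prod Finset.univ _ (fun i => prob_le_one)] at h
  rw [lintegral_finsetSum _ fun i _ => measurable_of_countable _] at h
  have h2 : ∀ i : Fin K, ∫⁻ a : Fin K → 𝒯, logLossBits (prior {a i}) ∂Measure.pi (fun _ => prior)
      = ENNReal.ofReal (entropyBits prior) := by
    intro i
    rw [← lintegral_logLossBits_self]
    exact (measurePreserving_eval (fun _ : Fin K => prior) i).lintegral_comp
      (f := fun a => logLossBits (prior {a})) (measurable_of_countable _)
  simp_rw [h2] at h
  rw [Finset.sum_const, Finset.card_univ, Fintype.card_fin, nsmul_eq_mul,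
    ← ENNReal.ofReal_natCast, ← ENNReal.ofReal_mul (Nat.cast_nonneg K),
    ENNReal.ofReal_eq_ofReal_iff (mul_nonneg (Nat.cast_nonneg K) (hnn _)) (hnn _)] at h
  exact h.symm

/-- A policy that verifies nothing. -/
def Policy.empty (𝒵 : Type*) [MeasurableSpace 𝒵] (K B : ℕ) : Policy 𝒵 K B where
  select := Kernel.const _ (Measure.dirac fun _ => false)
  isMarkov := inferInstance
  budget z := by simp [ae_dirac_eq]

lemma le_optGain (hW : IndepFun Prod.fst Prod.snd (stateOutputLaw prior W false))
    {I : ℝ} (hI0 : 0 ≤ I) (hIH : I ≤ entropyBits prior)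
    (hI : ∫⁻ y, logLossBits (informativePosterior prior W y.2 {y.1}) ∂stateOutputLaw prior W true
      = ENNReal.ofReal (entropyBits prior - I)) :
    I * expectedHits R P ≤ optGain prior R W K B := by
  have h : optLogLoss prior R W K B ≤ _ := iInf_le _ P
  rw [bayesLogLoss_outcomeLaw_eq prior W R P hW hI0 hIH hI] at h
  have h2 := ENNReal.toReal_mono ENNReal.ofReal_ne_top h
  rw [ENNReal.toReal_ofReal] at h2
  · rw [optGain, entropyBits_pi]
    linarith
  · have h3 := expectedHits_le R P
    have hK : (0 : ℝ) ≤ K := Nat.cast_nonneg K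
    nlinarith [mul_le_mul_of_nonneg_left h3 hI0, mul_le_mul_of_nonneg_left hIH hK]

lemma optGain_le (hW : IndepFun Prod.fst Prod.snd (stateOutputLaw prior W false))
    {I : ℝ} (hI0 : 0 ≤ I) (hIH : I ≤ entropyBits prior)
    (hI : ∫⁻ y, logLossBits (informativePosterior prior W y.2 {y.1}) ∂stateOutputLaw prior W true
      = ENNReal.ofReal (entropyBits prior - I)) {C : ℝ}
    (hC : ∀ P : Policy 𝒵 K B, expectedHits R P ≤ C) :
    optGain prior R W K B ≤ I * C := by
  have hlb : ENNReal.ofReal (K * entropyBits prior - I * C) ≤ optLogLoss prior R W K B := by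
    refine le_iInf fun P => ?_
    rw [bayesLogLoss_outcomeLaw_eq prior W R P hW hI0 hIH hI]
    refine ENNReal.ofReal_le_ofReal ?_
    linarith [mul_le_mul_of_nonneg_left (hC P) hI0]
  -- The empty policy has finite loss; without finiteness, `toReal` would return its default value 0
  -- for the infimum.
  have htop : optLogLoss prior R W K B ≠ ⊤ := by
    refine ne_top_of_le_ne_top ?_ (iInf_le _ (Policy.empty 𝒵 K B))
    rw [bayesLogLoss_outcomeLaw_eq prior W R _ hW hI0 hIH hI]
    exact ENNReal.ofReal_ne_top
  have := (ENNReal.ofReal_le_iff_le_toReal htop).1 hlb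
  rw [optGain, entropyBits_pi]
  linarith

end Haystack

/-! ### Mutual information with a finite-valued coordinate -/

namespace Haystack

open InformationTheory

section FiniteFirst

variable {A B : Type*} [Fintype A] [Nonempty A] [MeasurableSpace A] [MeasurableSingletonClass A]
  [MeasurableSpace B] (ρ : Measure (A × B)) [IsProbabilityMeasure ρ]

lemma measurable_condDistrib_real (a : A) :
    Measurable fun b => (condDistrib Prod.fst Prod.snd ρ b).real {a} :=
  (Kernel.measurable_coe _ (measurableSet_singleton a)).ennreal_toReal

lemma lintegral_condDistrib_singleton (a : A) :
    ∫⁻ b, condDistrib Prod.fst Prod.snd ρ b {a} ∂ρ.snd = ρ.fst {a} := by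
  have hi : Measurable (Set.indicator ({a} : Set A) (1 : A → ℝ≥0∞)) :=
    measurable_one.indicator (measurableSet_singleton a)
  have h := lintegral_eq_lintegral_condDistrib (ρ := ρ)
    (φ := fun x => Set.indicator {a} 1 x.1) (hi.comp measurable_fst)
  simp_rw [lintegral_indicator_one (measurableSet_singleton a)] at h
  rw [← h, ← lintegral_map (g := Prod.fst) hi measurable_fst]
  exact lintegral_indicator_one (measurableSet_singleton a)

lemma integral_condDistrib_real (a : A) :
    ∫ b, (condDistrib Prod.fst Prod.snd ρ b).real {a} ∂ρ.snd = ρ.fst.real {a} := by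
  rw [measureReal_def, ← lintegral_condDistrib_singleton ρ a]
  exact integral_toReal (Kernel.measurable_coe _ (measurableSet_singleton a)).aemeasurable
    (ae_of_all _ fun b => measure_lt_top _ _)

lemma ae_condDistrib_eq_zero (a : A) (ha : ρ.fst {a} = 0) :
    ∀ᵐ b ∂ρ.snd, condDistrib Prod.fst Prod.snd ρ b {a} = 0 := by
  have h := lintegral_condDistrib_singleton ρ a
  rw [ha, lintegral_eq_zero_iff (Kernel.measurable_coe _ (measurableSet_singleton a))] at h
  exact h

/-- The density of a joint law with respect to the product of its marginals. -/
def dependenceDensity (x : A × B) : ℝ :=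
  (condDistrib Prod.fst Prod.snd ρ x.2).real {x.1} / ρ.fst.real {x.1}

lemma dependenceDensity_nonneg (x : A × B) : 0 ≤ dependenceDensity ρ x :=
  div_nonneg measureReal_nonneg measureReal_nonneg

lemma measurable_dependenceDensity : Measurable (dependenceDensity ρ) := by
  refine measurable_from_prod_countable_right fun a => ?_
  exact (measurable_condDistrib_real ρ a).div_const (ρ.fst.real {a})

lemma withDensity_dependenceDensity :
    (ρ.fst.prod ρ.snd).withDensity (fun x => ENNReal.ofReal (dependenceDensity ρ x)) = ρ := by
  have hm := measurable_dependenceDensity ρ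
  ext s hs
  have hms : Measurable fun x : A × B => ENNReal.ofReal (dependenceDensity ρ x) * s.indicator 1 x :=
    hm.ennreal_ofReal.mul (measurable_one.indicator hs)
  rw [withDensity_apply _ hs, ← lintegral_indicator hs, ← lintegral_indicator_one (μ := ρ) hs]
  have e : ∀ x, s.indicator (fun x => ENNReal.ofReal (dependenceDensity ρ x)) x
      = ENNReal.ofReal (dependenceDensity ρ x) * s.indicator 1 x := fun x => by
    by_cases hx : x ∈ s <;> simp [hx]
  simp_rw [e]
  rw [lintegral_prod_symm _ hms.aemeasurable,
    lintegral_eq_lintegral_condDistrib (measurable_one.indicator hs)]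
  refine lintegral_congr_ae ?_
  have h0 : ∀ᵐ b ∂ρ.snd, ∀ a, ρ.fst {a} = 0 → condDistrib Prod.fst Prod.snd ρ b {a} = 0 := by
    rw [ae_all_iff]
    intro a
    by_cases ha : ρ.fst {a} = 0
    · filter_upwards [ae_condDistrib_eq_zero ρ a ha] with b hb _ using hb
    · exact ae_of_all _ fun b h => absurd h ha
  filter_upwards [h0] with b hb
  rw [lintegral_fintype, lintegral_fintype]
  refine Finset.sum_congr rfl fun a _ => ?_
  rw [mul_right_comm, mul_comm]
  congr 1
  -- At a null atom the density is 0 by the convention for division by zero, consistently with the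
  -- conditional probability vanishing almost everywhere.
  by_cases ha : ρ.fst {a} = 0
  · rw [ha, hb a ha, mul_zero]
  · have hp : 0 < ρ.fst.real {a} := ENNReal.toReal_pos ha (measure_ne_top _ _)
    rw [dependenceDensity, ENNReal.ofReal_div_of_pos hp, ofReal_measureReal, ofReal_measureReal]
    exact ENNReal.div_mul_cancel ha (measure_ne_top _ _)

/-- Mutual information as the expected relative entropy of the conditional law of the (finite-valued)
first coordinate with respect to its marginal law. -/
theorem mutualInfoBits_eq_integral :
    mutualInfoBits ρ = (∫ b, ∑ a, (condDistrib Prod.fst Prod.snd ρ b).real {a}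
      * (Real.log ((condDistrib Prod.fst Prod.snd ρ b).real {a})
        - Real.log (ρ.fst.real {a})) ∂ρ.snd) / Real.log 2 := by
  have hm := measurable_dependenceDensity ρ
  have hd := withDensity_dependenceDensity ρ
  have hac : ρ ≪ ρ.fst.prod ρ.snd := by
    conv_lhs => rw [← hd]
    exact withDensity_absolutelyContinuous _ _
  have hrn : (fun x => (ρ.rnDeriv (ρ.fst.prod ρ.snd) x).toReal)
      =ᵐ[ρ.fst.prod ρ.snd] dependenceDensity ρ := by
    have h := Measure.rnDeriv_withDensity (ρ.fst.prod ρ.snd) hm.ennreal_ofReal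
    rw [hd] at h
    filter_upwards [h] with x hx
    rw [hx, ENNReal.toReal_ofReal (dependenceDensity_nonneg ρ x)]
  have h0 : ∀ᵐ b ∂ρ.snd, ∀ a, ρ.fst {a} = 0 → condDistrib Prod.fst Prod.snd ρ b {a} = 0 := by
    rw [ae_all_iff]
    intro a
    by_cases ha : ρ.fst {a} = 0
    · filter_upwards [ae_condDistrib_eq_zero ρ a ha] with b hb _ using hb
    · exact ae_of_all _ fun b h => absurd h ha
  -- Finiteness of `A` bounds the density by the largest inverse atom mass, so `klFun` is evaluated
  -- on a compact interval. This supplies the integrability needed for Fubini.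
  have hbound : ∃ C, ∀ x, |klFun (dependenceDensity ρ x)| ≤ C := by
    obtain ⟨M, hM⟩ : ∃ M : ℝ, ∀ a, (ρ.fst.real {a})⁻¹ ≤ M := by
      obtain ⟨M, hM⟩ := (Set.finite_range fun a => (ρ.fst.real {a})⁻¹).bddAbove
      exact ⟨M, fun a => hM ⟨a, rfl⟩⟩
    have hc : ContinuousOn klFun (Set.Icc 0 M) := continuous_klFun.continuousOn
    obtain ⟨C, hC⟩ := isCompact_Icc.exists_bound_of_continuousOn hc
    refine ⟨C, fun x => hC _ ⟨dependenceDensity_nonneg ρ x, ?_⟩⟩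
    refine le_trans ?_ (hM x.1)
    rw [dependenceDensity, div_eq_mul_inv]
    exact mul_le_of_le_one_left (inv_nonneg.2 measureReal_nonneg) measureReal_le_one
  obtain ⟨C, hC⟩ := hbound
  have hint : Integrable (fun x => klFun (dependenceDensity ρ x)) (ρ.fst.prod ρ.snd) :=
    Integrable.of_bound (measurable_klFun.comp hm).aestronglyMeasurable C
      (ae_of_all _ fun x => hC x)
  rw [mutualInfoBits, toReal_klDiv_eq_integral_klFun hac]
  congr 1
  have hkl : ∫ x, klFun (ρ.rnDeriv (ρ.fst.prod ρ.snd) x).toReal ∂ρ.fst.prod ρ.snd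
      = ∫ x, klFun (dependenceDensity ρ x) ∂ρ.fst.prod ρ.snd := by
    refine integral_congr_ae ?_
    filter_upwards [hrn] with x hx
    rw [hx]
  rw [hkl, integral_prod_symm _ hint]
  refine integral_congr_ae ?_
  filter_upwards [h0] with b hb
  rw [integral_fintype .of_finite]
  simp only [smul_eq_mul]
  -- `klFun x` is x log x + 1 - x; its affine part leaves a difference of masses that sums to zero
  -- over `a`.
  have key : ∀ a, ρ.fst.real {a} * klFun (dependenceDensity ρ (a, b))
      = (condDistrib Prod.fst Prod.snd ρ b).real {a}
        * (Real.log ((condDistrib Prod.fst Prod.snd ρ b).real {a}) - Real.log (ρ.fst.real {a}))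
        + (ρ.fst.real {a} - (condDistrib Prod.fst Prod.snd ρ b).real {a}) := by
    intro a
    simp only [dependenceDensity]
    by_cases ha : ρ.fst {a} = 0
    · simp [measureReal_def, ha, hb a ha]
    · have hp : ρ.fst.real {a} ≠ 0 := (ENNReal.toReal_pos ha (measure_ne_top _ _)).ne'
      by_cases hk : (condDistrib Prod.fst Prod.snd ρ b).real {a} = 0
      · simp [hk, klFun]
      · rw [klFun, Real.log_div hk hp]
        field_simp
        ring
  simp_rw [key]
  rw [Finset.sum_add_distrib, Finset.sum_sub_distrib, sum_univ_measureReal_singleton,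
    sum_univ_measureReal_singleton]
  simp

lemma entropyBits_nonneg (μ : Measure A) [IsProbabilityMeasure μ] : 0 ≤ entropyBits μ :=
  Finset.sum_nonneg fun _ _ => div_nonneg
    (Real.negMulLog_nonneg measureReal_nonneg measureReal_le_one) (Real.log_pos one_lt_two).le

lemma negMulLog_le_one {x : ℝ} (hx : 0 ≤ x) : Real.negMulLog x ≤ 1 := by
  rcases hx.eq_or_lt with rfl | hx
  · simp
  · have := Real.log_le_sub_one_of_pos (inv_pos.2 hx)
    rw [Real.log_inv] at this
    have h2 := mul_le_mul_of_nonneg_left this hx.le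
    have h3 : x * (x⁻¹ - 1) = 1 - x := by field_simp
    rw [Real.negMulLog]
    nlinarith

lemma integrable_negMulLog_condDistrib (a : A) :
    Integrable (fun b => Real.negMulLog ((condDistrib Prod.fst Prod.snd ρ b).real {a})) ρ.snd := by
  refine Integrable.of_bound ((Real.continuous_negMulLog.measurable.comp
    (measurable_condDistrib_real ρ a))).aestronglyMeasurable 1 (ae_of_all _ fun b => ?_)
  rw [Real.norm_of_nonneg (Real.negMulLog_nonneg measureReal_nonneg measureReal_le_one)]
  exact negMulLog_le_one measureReal_nonneg

lemma integrable_condDistrib_real (a : A) :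
    Integrable (fun b => (condDistrib Prod.fst Prod.snd ρ b).real {a}) ρ.snd := by
  refine Integrable.of_bound (measurable_condDistrib_real ρ a).aestronglyMeasurable 1
    (ae_of_all _ fun b => ?_)
  rw [Real.norm_of_nonneg measureReal_nonneg]
  exact measureReal_le_one

lemma integrable_entropyBits_condDistrib :
    Integrable (fun b => entropyBits (condDistrib Prod.fst Prod.snd ρ b)) ρ.snd :=
  integrable_finsetSum _ fun a _ => (integrable_negMulLog_condDistrib ρ a).div_const _

/-- Mutual information as a difference of entropies. -/
theorem mutualInfoBits_eq_sub :
    mutualInfoBits ρ = entropyBits ρ.fst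
      - ∫ b, entropyBits (condDistrib Prod.fst Prod.snd ρ b) ∂ρ.snd := by
  have e : ∀ b, ∑ a, (condDistrib Prod.fst Prod.snd ρ b).real {a}
      * (Real.log ((condDistrib Prod.fst Prod.snd ρ b).real {a}) - Real.log (ρ.fst.real {a}))
      = (∑ a, (condDistrib Prod.fst Prod.snd ρ b).real {a} * -Real.log (ρ.fst.real {a}))
        - ∑ a, Real.negMulLog ((condDistrib Prod.fst Prod.snd ρ b).real {a}) := by
    intro b
    rw [← Finset.sum_sub_distrib]
    refine Finset.sum_congr rfl fun a _ => ?_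
    rw [Real.negMulLog]; ring
  rw [mutualInfoBits_eq_integral]
  simp_rw [e]
  rw [integral_sub (integrable_finsetSum _ fun a _ => (integrable_condDistrib_real ρ a).mul_const _)
    (integrable_finsetSum _ fun a _ => integrable_negMulLog_condDistrib ρ a),
    integral_finsetSum _ fun a _ => (integrable_condDistrib_real ρ a).mul_const _, sub_div]
  congr 1
  · rw [entropyBits, Finset.sum_div]
    refine Finset.sum_congr rfl fun a _ => ?_
    rw [integral_mul_const, integral_condDistrib_real, Real.negMulLog]
    ring
  · simp_rw [entropyBits, ← Finset.sum_div]
    rw [integral_div]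

end FiniteFirst

section Verification

variable {𝒯 𝒱 : Type*} [Fintype 𝒯] [Nonempty 𝒯] [MeasurableSpace 𝒯] [MeasurableSingletonClass 𝒯]
  [MeasurableSpace 𝒱] (prior : Measure 𝒯) [IsProbabilityMeasure prior]
  (W : Kernel (𝒯 × Bool) 𝒱) [IsMarkovKernel W]

lemma verInfo_nonneg : 0 ≤ verInfo prior W :=
  div_nonneg ENNReal.toReal_nonneg (Real.log_pos one_lt_two).le

lemma verInfo_eq_sub : verInfo prior W = entropyBits prior
    - ∫ v, entropyBits (informativePosterior prior W v) ∂(stateOutputLaw prior W true).snd := by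
  rw [verInfo, mutualInfoBits_eq_sub, fst_stateOutputLaw]
  rfl

lemma verInfo_le : verInfo prior W ≤ entropyBits prior := by
  have : 0 ≤ ∫ v, entropyBits (informativePosterior prior W v)
      ∂(stateOutputLaw prior W true).snd := integral_nonneg fun v => entropyBits_nonneg _
  linarith [verInfo_eq_sub prior W]

/-- The log-loss of the posterior given an informative output. -/
lemma lintegral_logLossBits_informativePosterior :
    ∫⁻ y, logLossBits (informativePosterior prior W y.2 {y.1}) ∂stateOutputLaw prior W true
      = ENNReal.ofReal (entropyBits prior - verInfo prior W) := by
  have h1 : Measurable fun u : 𝒱 × 𝒯 => informativePosterior prior W u.1 {u.2} :=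
    measurable_from_prod_countable_left fun θ =>
      Kernel.measurable_coe _ (measurableSet_singleton θ)
  have h2 : Measurable fun y : 𝒯 × 𝒱 => logLossBits (informativePosterior prior W y.2 {y.1}) :=
    measurable_logLossBits.comp (h1.comp measurable_swap)
  rw [lintegral_stateOutputLaw_true _ _ h2]
  simp_rw [lintegral_logLossBits_self]
  rw [← ofReal_integral_eq_lintegral_ofReal, verInfo_eq_sub, sub_sub_cancel]
  · exact integrable_entropyBits_condDistrib _
  · exact ae_of_all _ fun v => entropyBits_nonneg _

end Verification

end Haystack

namespace Haystack

/-! The logistic function. -/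

/-- The derivative of the logistic function. -/
def logisticSlope (x : ℝ) : ℝ := Real.sigmoid x * (1 - Real.sigmoid x)

lemma hasDerivAt_sigmoid' (x : ℝ) : HasDerivAt Real.sigmoid (logisticSlope x) x :=
  Real.hasDerivAt_sigmoid x

lemma logisticSlope_pos (x : ℝ) : 0 < logisticSlope x :=
  mul_pos (Real.sigmoid_pos x) (by linarith [Real.sigmoid_lt_one x])

lemma logisticSlope_le (x : ℝ) : logisticSlope x ≤ 1 / 4 := by
  unfold logisticSlope; nlinarith [sq_nonneg (Real.sigmoid x - 1 / 2)]

lemma abs_sigmoid_sub_le (x y : ℝ) : |Real.sigmoid x - Real.sigmoid y| ≤ 1 / 4 * |x - y| := by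
  have := convex_univ.norm_image_sub_le_of_norm_hasDerivWithin_le (f := Real.sigmoid)
    (f' := logisticSlope) (C := 1 / 4) (x := y) (y := x)
    (fun x _ => (hasDerivAt_sigmoid' x).hasDerivWithinAt)
    (fun x _ => by rw [Real.norm_of_nonneg (logisticSlope_pos x).le]; exact logisticSlope_le x)
    (Set.mem_univ _) (Set.mem_univ _)
  simpa using this

/-- The slope is s(1 - s) as a function of s = σ(x), and s(1 - s) - t(1 - t) = (s - t)(1 - s - t)
with the last factor in [-1, 1]. -/
lemma abs_logisticSlope_sub_le_sigmoid (x y : ℝ) :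
    |logisticSlope x - logisticSlope y| ≤ |Real.sigmoid x - Real.sigmoid y| := by
  have e : logisticSlope x - logisticSlope y
      = (Real.sigmoid x - Real.sigmoid y) * (1 - Real.sigmoid x - Real.sigmoid y) := by
    unfold logisticSlope; ring
  rw [e, abs_mul]
  refine mul_le_of_le_one_right (abs_nonneg _) (abs_le.2 ⟨?_, ?_⟩)
  · linarith [Real.sigmoid_lt_one x, Real.sigmoid_lt_one y]
  · linarith [Real.sigmoid_pos x, Real.sigmoid_pos y]

lemma abs_logisticSlope_sub_le (x y : ℝ) :
    |logisticSlope x - logisticSlope y| ≤ |x - y| := by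
  have := abs_logisticSlope_sub_le_sigmoid x y
  have := abs_sigmoid_sub_le x y
  have := abs_nonneg (x - y)
  linarith

/-- First-order expansion of the logistic function. -/
lemma abs_sigmoid_add_sub_le (c u : ℝ) :
    |Real.sigmoid (c + u) - Real.sigmoid c - logisticSlope c * u| ≤ u ^ 2 := by
  have hd : ∀ t, HasDerivAt (fun t => Real.sigmoid (c + t) - logisticSlope c * t)
      (logisticSlope (c + t) - logisticSlope c) t := by
    intro t
    have h1 := (hasDerivAt_sigmoid' (c + t)).comp_const_add c t
    simpa using h1.fun_sub ((hasDerivAt_id t).const_mul (logisticSlope c))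
  -- The remainder has derivative at most |u| on the segment from 0 to `u`, so the mean value
  -- inequality gives u².
  have := (convex_uIcc 0 u).norm_image_sub_le_of_norm_hasDerivWithin_le (C := |u|) (x := 0) (y := u)
    (fun t _ => (hd t).hasDerivWithinAt)
    (fun t ht => by
      refine (abs_logisticSlope_sub_le (c + t) c).trans ?_
      rw [add_sub_cancel_left]
      simpa using Set.abs_sub_left_of_mem_uIcc ht)
    Set.left_mem_uIcc Set.right_mem_uIcc
  simp only [Real.norm_eq_abs, add_zero, mul_zero, sub_zero] at this
  rw [← sq_abs u, sq]
  convert this using 2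
  ring

/-! ### Bernoulli relative entropy in log-odds coordinates -/

/-- Relative entropy between Bernoulli laws, in nats. -/
def bernoulliDiv (x r : ℝ) : ℝ :=
  x * (Real.log x - Real.log r) + (1 - x) * (Real.log (1 - x) - Real.log (1 - r))

lemma log_sigmoid_sub_log (x : ℝ) :
    Real.log (Real.sigmoid x) - Real.log (1 - Real.sigmoid x) = x := by
  have h1 := Real.sigmoid_pos x
  have h2 : 0 < 1 - Real.sigmoid x := by linarith [Real.sigmoid_lt_one x]
  rw [← Real.sigmoid_neg, ← Real.sigmoid_mul_rexp_neg, Real.log_mul h1.ne' (Real.exp_pos _).ne',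
    Real.log_exp]
  ring

/-- The derivative of the divergence in its first argument is a difference of log-odds, and
`Real.sigmoid` inverts the log-odds map. In this coordinate Pinsker's inequality and the quadratic
upper bound both become ratio comparisons with an elementary function. -/
lemma hasDerivAt_bernoulliDiv_sigmoid (c x : ℝ) :
    HasDerivAt (fun x => bernoulliDiv (Real.sigmoid x) (Real.sigmoid c))
      ((x - c) * logisticSlope x) x := by
  have h1 := Real.sigmoid_pos x
  have h2 : 0 < 1 - Real.sigmoid x := by linarith [Real.sigmoid_lt_one x]
  have hs := hasDerivAt_sigmoid' x
  have hs' := hs.const_sub 1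
  have h := (hs.mul ((hs.log h1.ne').sub_const (Real.log (Real.sigmoid c)))).add
    (hs'.mul ((hs'.log h2.ne').sub_const (Real.log (1 - Real.sigmoid c))))
  refine h.congr_deriv ?_
  have e1 := log_sigmoid_sub_log x
  have e2 := log_sigmoid_sub_log c
  have e : x - c = (Real.log (Real.sigmoid x) - Real.log (1 - Real.sigmoid x))
    - (Real.log (Real.sigmoid c) - Real.log (1 - Real.sigmoid c)) := by rw [e1, e2]
  rw [e]
  field_simp
  ring

/-- Generalized mean value theorem for the Bernoulli relative entropy in log-odds coordinates. -/
lemma exists_bernoulliDiv_mul_eq {c x : ℝ} (hcx : c ≠ x) {g g' : ℝ → ℝ}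
    (hg : ∀ t, HasDerivAt g (g' t) t) (hgc : g c = 0) :
    ∃ ξ ∈ Set.uIcc c x, ξ ≠ c ∧
      bernoulliDiv (Real.sigmoid x) (Real.sigmoid c) * g' ξ
        = g x * ((ξ - c) * logisticSlope ξ) := by
  set F := fun x => bernoulliDiv (Real.sigmoid x) (Real.sigmoid c)
  have hF := hasDerivAt_bernoulliDiv_sigmoid c
  have hFc : F c = 0 := by simp [F, bernoulliDiv]
  rcases hcx.lt_or_gt with h | h
  · obtain ⟨ξ, hξ, e⟩ := exists_ratio_hasDerivAt_eq_ratio_slope F _ h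
      (fun t _ => (hF t).continuousAt.continuousWithinAt) (fun t _ => hF t) g g'
      (fun t _ => (hg t).continuousAt.continuousWithinAt) (fun t _ => hg t)
    refine ⟨ξ, Set.Icc_subset_uIcc (Set.Ioo_subset_Icc_self hξ), hξ.1.ne', ?_⟩
    rw [hFc, hgc, sub_zero, sub_zero] at e
    exact e.symm
  · obtain ⟨ξ, hξ, e⟩ := exists_ratio_hasDerivAt_eq_ratio_slope F _ h
      (fun t _ => (hF t).continuousAt.continuousWithinAt) (fun t _ => hF t) g g'
      (fun t _ => (hg t).continuousAt.continuousWithinAt) (fun t _ => hg t)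
    refine ⟨ξ, Set.Icc_subset_uIcc' (Set.Ioo_subset_Icc_self hξ), hξ.2.ne, ?_⟩
    rw [hFc, hgc, zero_sub, zero_sub] at e
    change F x * g' ξ = _
    linarith

/-- Pinsker's inequality for Bernoulli laws. -/
lemma two_mul_sq_le_bernoulliDiv (x c : ℝ) :
    2 * (Real.sigmoid x - Real.sigmoid c) ^ 2
      ≤ bernoulliDiv (Real.sigmoid x) (Real.sigmoid c) := by
  rcases eq_or_ne c x with rfl | hcx
  · simp [bernoulliDiv]
  obtain ⟨ξ, -, hξ, e⟩ := exists_bernoulliDiv_mul_eq hcx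
    (g := fun t => (Real.sigmoid t - Real.sigmoid c) ^ 2)
    (g' := fun t => 2 * (Real.sigmoid t - Real.sigmoid c) * logisticSlope t)
    (fun t => by simpa using ((hasDerivAt_sigmoid' t).sub_const (Real.sigmoid c)).fun_pow 2) (by simp)
  have hs := logisticSlope_pos ξ
  have hl := abs_sigmoid_sub_le ξ c
  set D := bernoulliDiv (Real.sigmoid x) (Real.sigmoid c)
  set y := (Real.sigmoid x - Real.sigmoid c) ^ 2
  have hy : 0 ≤ y := sq_nonneg _
  -- After the common slope is cancelled, the 1/4-Lipschitz bound, which gives |ξ - c| ≥ 4 |σ(ξ) -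
  -- σ(c)|, forces D ≥ 2y for either sign of ξ - c.
  have e' : D * (2 * (Real.sigmoid ξ - Real.sigmoid c)) = y * (ξ - c) := by
    have : (D * (2 * (Real.sigmoid ξ - Real.sigmoid c))) * logisticSlope ξ
        = (y * (ξ - c)) * logisticSlope ξ := by linarith
    exact mul_right_cancel₀ hs.ne' this
  rcases hξ.lt_or_gt with h | h
  · have hlt := Real.sigmoid_lt h
    rw [abs_of_neg (by linarith), abs_of_neg (by linarith)] at hl
    have : (2 * y - D) * (Real.sigmoid c - Real.sigmoid ξ) ≤ 0 := by
      nlinarith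
    by_contra hcon
    have : 0 < (2 * y - D) * (Real.sigmoid c - Real.sigmoid ξ) :=
      mul_pos (by linarith) (by linarith)
    linarith
  · have hlt := Real.sigmoid_lt h
    rw [abs_of_pos (by linarith), abs_of_pos (by linarith)] at hl
    have : (2 * y - D) * (Real.sigmoid ξ - Real.sigmoid c) ≤ 0 := by
      nlinarith
    by_contra hcon
    have : 0 < (2 * y - D) * (Real.sigmoid ξ - Real.sigmoid c) :=
      mul_pos (by linarith) (by linarith)
    linarith

lemma bernoulliDiv_nonneg (x c : ℝ) : 0 ≤ bernoulliDiv (Real.sigmoid x) (Real.sigmoid c) :=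
  (by positivity : (0 : ℝ) ≤ _).trans (two_mul_sq_le_bernoulliDiv x c)

/-- Second-order upper bound for the Bernoulli relative entropy in log-odds coordinates. -/
lemma bernoulliDiv_sigmoid_add_le (c u : ℝ) :
    bernoulliDiv (Real.sigmoid (c + u)) (Real.sigmoid c)
      ≤ logisticSlope c / 2 * u ^ 2 + |u| ^ 3 := by
  rcases eq_or_ne u 0 with rfl | hu
  · simp [bernoulliDiv]
  obtain ⟨ξ, hmem, hξ, e⟩ := exists_bernoulliDiv_mul_eq (c := c) (x := c + u) (by simpa using hu)
    (g := fun t => (t - c) ^ 2) (g' := fun t => 2 * (t - c))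
    (fun t => by simpa using ((hasDerivAt_id t).sub_const c).fun_pow 2) (by simp)
  simp only [add_sub_cancel_left] at e
  have hne : ξ - c ≠ 0 := sub_ne_zero.2 hξ
  -- The divergence equals u²/2 times the slope at an intermediate point, and that slope exceeds the
  -- one at `c` by at most |u|.
  have e' : bernoulliDiv (Real.sigmoid (c + u)) (Real.sigmoid c) = u ^ 2 * logisticSlope ξ / 2 := by
    have : bernoulliDiv (Real.sigmoid (c + u)) (Real.sigmoid c) * 2 * (ξ - c)
        = u ^ 2 * logisticSlope ξ * (ξ - c) := by linarith
    have := mul_right_cancel₀ hne this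
    linarith
  have h1 := (abs_le.1 (abs_logisticSlope_sub_le ξ c)).2
  have h2 : |ξ - c| ≤ |u| := by simpa using Set.abs_sub_left_of_mem_uIcc hmem
  have h3 : |u| ^ 3 = u ^ 2 * |u| := by rw [← sq_abs u]; ring
  rw [e', h3]
  nlinarith [mul_nonneg (sq_nonneg u) (abs_nonneg u),
    mul_le_mul_of_nonneg_left (h1.trans h2) (sq_nonneg u)]

end Haystack

/-! ### Law of the Bayes score and its screening information -/

namespace Haystack

section Score

variable {𝒵 : Type*} [MeasurableSpace 𝒵] {R : Measure (Bool × 𝒵)} [IsProbabilityMeasure R]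

lemma eq_sigmoid_of_log_div_eq {x y : ℝ} (hx : x ∈ Set.Ioo (0 : ℝ) 1)
    (h : Real.log (x / (1 - x)) = y) : x = Real.sigmoid y := by
  have h1 : 0 < 1 - x := by linarith [hx.2]
  have hx0 := hx.1
  have h2 := Real.exp_log (div_pos hx0 h1)
  rw [h] at h2
  rw [Real.sigmoid_def, Real.exp_neg, h2]
  field_simp
  ring

/-- The law of the Bayes score is the law of `σ(b + ε G)`. -/
lemma map_bayesScore {γ : Measure ℝ} {b ε : ℝ} (h : HasLogOddsScore R γ b ε) :
    (R.snd).map (bayesScore R) = γ.map fun g => Real.sigmoid (b + ε * g) := by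
  obtain ⟨ρ, hR, hγ, hae⟩ := h
  have hη := measurable_bayesScore R
  have hσ : Measurable fun g => Real.sigmoid (b + ε * g) :=
    (continuous_sigmoid.comp (by fun_prop)).measurable
  have e1 : (R.snd).map (bayesScore R) = ρ.map fun x => bayesScore R x.1.2 := by
    have e2 : R.snd = ρ.map fun x => x.1.2 := by
      rw [← hR, Measure.snd, Measure.fst, Measure.map_map (by fun_prop) (by fun_prop)]
      rfl
    rw [e2, Measure.map_map hη (by fun_prop)]
    rfl
  rw [e1, ← hγ, Measure.snd, Measure.map_map hσ measurable_snd]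
  refine Measure.map_congr ?_
  filter_upwards [hae] with x hx
  exact eq_sigmoid_of_log_div_eq hx.1 hx.2

lemma integral_comp_bayesScore {γ : Measure ℝ} {b ε : ℝ} (h : HasLogOddsScore R γ b ε)
    {φ : ℝ → ℝ} (hφ : Measurable φ) :
    ∫ z, φ (bayesScore R z) ∂(R.snd) = ∫ g, φ (Real.sigmoid (b + ε * g)) ∂γ := by
  have hσ : Measurable fun g => Real.sigmoid (b + ε * g) :=
    (continuous_sigmoid.comp (by fun_prop)).measurable
  rw [← integral_map (measurable_bayesScore R).aemeasurable hφ.aestronglyMeasurable,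
    map_bayesScore h, integral_map hσ.aemeasurable hφ.aestronglyMeasurable]

lemma integral_bayesScore : ∫ z, bayesScore R z ∂(R.snd) = R.fst.real {true} :=
  integral_condDistrib_real R true

lemma measurable_bernoulliDiv (r : ℝ) : Measurable fun x => bernoulliDiv x r := by
  unfold bernoulliDiv; fun_prop

/-- The screening information is the expected Bernoulli relative entropy of the score. -/
lemma mutualInfoBits_eq_bernoulliDiv :
    mutualInfoBits R
      = (∫ z, bernoulliDiv (bayesScore R z) (R.fst.real {true}) ∂(R.snd)) / Real.log 2 := by
  rw [mutualInfoBits_eq_integral]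
  have h1 : R.fst.real {false} = 1 - R.fst.real {true} := by
    have := sum_univ_measureReal_singleton R.fst
    rw [Fintype.sum_bool] at this
    linarith
  have h2 : ∀ z, (condDistrib (Prod.fst : Bool × 𝒵 → Bool) Prod.snd R z).real {false}
      = 1 - bayesScore R z := by
    intro z
    have := sum_univ_measureReal_singleton (condDistrib (Prod.fst : Bool × 𝒵 → Bool) Prod.snd R z)
    rw [Fintype.sum_bool] at this
    rw [bayesScore]
    linarith
  simp_rw [Fintype.sum_bool, h1, h2]
  rfl

lemma mutualInfoBits_mul_log_two {γ : Measure ℝ} {b ε p : ℝ} (h : HasLogOddsScore R γ b ε)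
    (hp : R.fst.real {true} = p) :
    mutualInfoBits R * Real.log 2 = ∫ g, bernoulliDiv (Real.sigmoid (b + ε * g)) p ∂γ := by
  rw [mutualInfoBits_eq_bernoulliDiv, hp, div_mul_cancel₀ _ (Real.log_pos one_lt_two).ne',
    integral_comp_bayesScore h (measurable_bernoulliDiv p)]

lemma mutualInfoBits_nonneg {A B : Type*} [MeasurableSpace A] [MeasurableSpace B]
    (μ : Measure (A × B)) : 0 ≤ mutualInfoBits μ :=
  div_nonneg ENNReal.toReal_nonneg (Real.log_pos one_lt_two).le

end Score

lemma exists_sigmoid_eq {p : ℝ} (hp : p ∈ Set.Ioo (0 : ℝ) 1) : ∃ c, Real.sigmoid c = p := by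
  rw [← Real.range_sigmoid] at hp
  exact hp

/-- A crude uniform bound, serving only integrability: the entropy terms are at most 1 and the cross
terms are linear in `x`. -/
lemma abs_bernoulliDiv_le {x : ℝ} (hx : x ∈ Set.Icc (0 : ℝ) 1) (r : ℝ) :
    |bernoulliDiv x r| ≤ 2 + |Real.log r| + |Real.log (1 - r)| := by
  have e : bernoulliDiv x r = -Real.negMulLog x - Real.negMulLog (1 - x) - x * Real.log r
      - (1 - x) * Real.log (1 - r) := by
    simp only [bernoulliDiv, Real.negMulLog]; ring
  have a1 := negMulLog_le_one hx.1
  have a2 := negMulLog_le_one (x := 1 - x) (by linarith [hx.2])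
  have a3 := Real.negMulLog_nonneg hx.1 hx.2
  have a4 := Real.negMulLog_nonneg (x := 1 - x) (by linarith [hx.2]) (by linarith [hx.1])
  have a5 : |x * Real.log r| ≤ |Real.log r| := by
    rw [abs_mul, abs_of_nonneg hx.1]
    exact mul_le_of_le_one_left (abs_nonneg _) hx.2
  have a6 : |(1 - x) * Real.log (1 - r)| ≤ |Real.log (1 - r)| := by
    rw [abs_mul, abs_of_nonneg (by linarith [hx.2])]
    exact mul_le_of_le_one_left (abs_nonneg _) (by linarith [hx.1])
  rw [e, abs_le]
  rw [abs_le] at a5 a6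
  constructor <;> linarith [a5.1, a5.2, a6.1, a6.2]

section ScoreLaw

variable {γ : Measure ℝ} [IsProbabilityMeasure γ] (b ε : ℝ)

lemma sigmoid_mem_Icc (x : ℝ) : Real.sigmoid x ∈ Set.Icc (0 : ℝ) 1 :=
  ⟨Real.sigmoid_nonneg x, Real.sigmoid_le_one x⟩

lemma measurable_sigmoid_affine : Measurable fun g => Real.sigmoid (b + ε * g) :=
  (continuous_sigmoid.comp (by fun_prop)).measurable

lemma integrable_sigmoid_affine : Integrable (fun g => Real.sigmoid (b + ε * g)) γ :=
  Integrable.of_bound (measurable_sigmoid_affine b ε).aestronglyMeasurable 1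
    (ae_of_all _ fun g => by
      rw [Real.norm_of_nonneg (Real.sigmoid_nonneg _)]; exact Real.sigmoid_le_one _)

lemma integrable_bernoulliDiv_sigmoid (r : ℝ) :
    Integrable (fun g => bernoulliDiv (Real.sigmoid (b + ε * g)) r) γ :=
  Integrable.of_bound
    ((measurable_bernoulliDiv r).comp (measurable_sigmoid_affine b ε)).aestronglyMeasurable _
    (ae_of_all _ fun _ => abs_bernoulliDiv_le (sigmoid_mem_Icc _) r)

lemma integrable_sq_sigmoid_sub (r : ℝ) :
    Integrable (fun g => (Real.sigmoid (b + ε * g) - r) ^ 2) γ := by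
  refine Integrable.of_bound
    (((measurable_sigmoid_affine b ε).sub_const r).pow_const 2).aestronglyMeasurable
    ((1 + |r|) ^ 2) (ae_of_all _ fun g => ?_)
  rw [Real.norm_of_nonneg (sq_nonneg _), ← sq_abs]
  gcongr
  refine (abs_sub _ _).trans ?_
  gcongr
  rw [abs_of_nonneg (Real.sigmoid_nonneg _)]
  exact Real.sigmoid_le_one _

/-- Pinsker's inequality, integrated against the law of the score. -/
lemma two_mul_integral_sq_le {p : ℝ} (hp : p ∈ Set.Ioo (0 : ℝ) 1) :
    2 * ∫ g, (Real.sigmoid (b + ε * g) - p) ^ 2 ∂γ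
      ≤ ∫ g, bernoulliDiv (Real.sigmoid (b + ε * g)) p ∂γ := by
  obtain ⟨c, rfl⟩ := exists_sigmoid_eq hp
  rw [← integral_const_mul]
  exact integral_mono ((integrable_sq_sigmoid_sub b ε _).const_mul 2)
    (integrable_bernoulliDiv_sigmoid b ε _) fun g => two_mul_sq_le_bernoulliDiv _ _

end ScoreLaw

/-! ### Converse: a variance bound on expected hits -/

section UpperBound

variable {𝒵 : Type*} [MeasurableSpace 𝒵] {R : Measure (Bool × 𝒵)} [IsProbabilityMeasure R]
  {K B : ℕ}

lemma Policy.sum_select_le (P : Policy 𝒵 K B) (z : Fin K → 𝒵) :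
    ∑ i, (P.select z).real {S | S i = true} ≤ B := by
  have := P.isMarkov
  have h1 : ∀ i : Fin K, (P.select z).real {S | S i = true}
      = ∫ S, (if S i = true then (1 : ℝ) else 0) ∂P.select z := by
    intro i
    rw [← integral_indicator_one (Set.toFinite _).measurableSet]
    refine integral_congr_ae (ae_of_all _ fun S => ?_)
    by_cases h : S i = true <;> simp [h]
  simp_rw [h1]
  rw [← integral_finsetSum _ fun i _ => .of_finite]
  have h2 : ∫ S, ∑ i, (if S i = true then (1 : ℝ) else 0) ∂P.select z
      ≤ ∫ _, (B : ℝ) ∂P.select z := by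
    refine integral_mono_ae .of_finite (integrable_const _) ?_
    filter_upwards [P.budget z] with S hS
    rw [Finset.sum_boole]
    exact_mod_cast hS
  simpa using h2

lemma integrable_comp_bayesScore {φ : ℝ → ℝ} (hφ : Measurable φ) {C : ℝ}
    (hC : ∀ x ∈ Set.Icc (0 : ℝ) 1, |φ x| ≤ C) : Integrable (fun z => φ (bayesScore R z)) R.snd :=
  Integrable.of_bound (hφ.comp (measurable_bayesScore R)).aestronglyMeasurable C
    (ae_of_all _ fun z => hC _ ⟨bayesScore_nonneg R z, bayesScore_le_one R z⟩)

/-- No policy finds many more informative records than random verification, in terms of the variance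
of the score. -/
theorem expectedHits_le_of_variance (P : Policy 𝒵 K B) {p : ℝ} (hp : 0 ≤ p) :
    expectedHits R P
      ≤ B * p + Real.sqrt (B * (K * ∫ z, (bayesScore R z - p) ^ 2 ∂(R.snd))) := by
  have := P.isMarkov
  set V := ∫ z, (bayesScore R z - p) ^ 2 ∂(R.snd) with hV
  set π : Measure (Fin K → 𝒵) := Measure.pi fun _ => R.snd
  set a : Fin K → (Fin K → 𝒵) → ℝ := fun i z => (P.select z).real {S | S i = true} with ha
  have ha0 : ∀ i z, 0 ≤ a i z := fun i z => measureReal_nonneg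
  have ha1 : ∀ i z, a i z ≤ 1 := fun i z => measureReal_le_one
  have ham : ∀ i, Measurable (a i) := fun i => measurable_select_real P i
  have hη := measurable_bayesScore R
  have hsqint : Integrable (fun z => (bayesScore R z - p) ^ 2) R.snd := by
    refine integrable_comp_bayesScore (φ := fun x => (x - p) ^ 2) (by fun_prop)
      (C := (1 + p) ^ 2) fun x hx => ?_
    rw [abs_of_nonneg (sq_nonneg _), ← sq_abs]
    gcongr
    rw [abs_le]; constructor <;> linarith [hx.1, hx.2]
  have hcomp : ∀ i : Fin K, Integrable (fun z => (bayesScore R (z i) - p) ^ 2) π := fun i =>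
    (measurePreserving_eval (fun _ : Fin K => R.snd) i).integrable_comp_of_integrable hsqint
  have hsq : ∫ z, ∑ i : Fin K, (bayesScore R (z i) - p) ^ 2 ∂π = K * V := by
    rw [integral_finsetSum _ fun i _ => hcomp i]
    simp_rw [π, integral_comp_eval (μ := fun _ : Fin K => R.snd) hsqint.aestronglyMeasurable]
    simp [hV]
  have hsqi : Integrable (fun z => ∑ i : Fin K, (bayesScore R (z i) - p) ^ 2) π :=
    integrable_finsetSum _ fun i _ => hcomp i
  set X := ∫ z, ∑ i, a i z * (bayesScore R (z i) - p) ∂π with hX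
  have hai : ∀ i, Integrable (a i) π := fun i =>
    Integrable.of_bound (ham i).aestronglyMeasurable 1 (ae_of_all _ fun z => by
      rw [Real.norm_of_nonneg (ha0 i z)]; exact ha1 i z)
  have hhit : ∀ i, Integrable (fun z => a i z * bayesScore R (z i)) π := integrable_hits R P
  have hXi : Integrable (fun z => ∑ i, a i z * (bayesScore R (z i) - p)) π := by
    simp_rw [mul_sub]
    exact integrable_finsetSum _ fun i _ => (hhit i).sub ((hai i).mul_const p)
  have hXle : expectedHits R P ≤ B * p + X := by
    have h1 : expectedHits R P = X + ∫ z, (∑ i, a i z) * p ∂π := by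
      rw [hX, ← integral_add hXi ((integrable_finsetSum _ fun i _ => hai i).mul_const p)]
      refine integral_congr_ae (ae_of_all _ fun z => ?_)
      simp only [ha]
      rw [Finset.sum_mul, ← Finset.sum_add_distrib]
      exact Finset.sum_congr rfl fun i _ => by ring
    have h2 : ∫ z, (∑ i, a i z) * p ∂π ≤ ∫ _, B * p ∂π :=
      integral_mono ((integrable_finsetSum _ fun i _ => hai i).mul_const p)
        (integrable_const _) fun z => mul_le_mul_of_nonneg_right (P.sum_select_le z) hp
    simp only [integral_const, probReal_univ, one_smul] at h2
    linarith
  -- Cauchy-Schwarz in discriminant form. Since the selection probabilities satisfy a² ≤ a, the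
  -- budget bounds the sum of their squares by `B`.
  have hdisc : ∀ t : ℝ, 0 ≤ B * (t * t) + (-2 * X) * t + K * V := by
    intro t
    have h1 : ∫ z, 2 * t * ∑ i, a i z * (bayesScore R (z i) - p) ∂π
        ≤ ∫ z, (t ^ 2 * B + ∑ i : Fin K, (bayesScore R (z i) - p) ^ 2) ∂π := by
      refine integral_mono (hXi.const_mul _) ((integrable_const _).add hsqi) fun z => ?_
      have hS := P.sum_select_le z
      have : ∀ i ∈ Finset.univ, 2 * t * (a i z * (bayesScore R (z i) - p))
          ≤ t ^ 2 * a i z + (bayesScore R (z i) - p) ^ 2 := by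
        intro i _
        have h0 := ha0 i z
        have h1 := ha1 i z
        nlinarith [sq_nonneg (t * a i z - (bayesScore R (z i) - p)),
          mul_nonneg (sq_nonneg t) (mul_nonneg h0 (sub_nonneg.2 h1))]
      have h3 := Finset.sum_le_sum this
      rw [Finset.sum_add_distrib, ← Finset.mul_sum, ← Finset.mul_sum] at h3
      have h4 := mul_le_mul_of_nonneg_left hS (sq_nonneg t)
      dsimp only
      linarith
    rw [integral_const_mul, integral_add (integrable_const _) hsqi, hsq, ← hX] at h1
    simp only [integral_const, probReal_univ, one_smul] at h1
    nlinarith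
  have := discrim_le_zero hdisc
  rw [discrim] at this
  have h2 : X ≤ Real.sqrt (B * (K * V)) := Real.le_sqrt_of_sq_le (by nlinarith)
  linarith

end UpperBound

end Haystack

/-! ### Standardized scores: quantiles, tail means and small-ε estimates -/

namespace Haystack

lemma _root_.MeasureTheory.Integrable.fun_sub {X : Type*} [MeasurableSpace X] {μ : Measure X}
    {f g : X → ℝ} (hf : Integrable f μ) (hg : Integrable g μ) :
    Integrable (fun x => f x - g x) μ := hf.sub hg

section StandardScore

variable {γ : Measure ℝ}

lemma IsStandardScoreLaw.integrable_sq (hγ : IsStandardScoreLaw γ) :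
    Integrable (fun g : ℝ => g ^ 2) γ := by
  have := hγ.prob
  refine Integrable.mono' ((integrable_const (1 : ℝ)).fun_add hγ.third_moment) (by fun_prop)
    (ae_of_all _ fun g => ?_)
  simp only [Real.norm_eq_abs, abs_pow]
  have := abs_nonneg g
  rcases le_total |g| 1 with h | h <;> nlinarith [pow_nonneg this 2, pow_nonneg this 3]

lemma IsStandardScoreLaw.integrable_id (hγ : IsStandardScoreLaw γ) :
    Integrable (fun g : ℝ => g) γ := by
  have := hγ.prob
  refine Integrable.mono' ((integrable_const (1 : ℝ)).fun_add hγ.integrable_sq) (by fun_prop)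
    (ae_of_all _ fun g => ?_)
  simp only [Real.norm_eq_abs]
  nlinarith [sq_nonneg (|g| - 1), sq_abs g, abs_nonneg g]

/-- The upper quantile is attained. -/
lemma IsStandardScoreLaw.measureReal_Ici_upperQuantile (hγ : IsStandardScoreLaw γ) {α : ℝ}
    (hα : α ∈ Set.Ioo (0 : ℝ) 1) : γ.real (Set.Ici (upperQuantile γ α)) = α := by
  have := hγ.prob
  set q := upperQuantile γ α with hq
  set A := {q : ℝ | 1 - α ≤ γ.real (Set.Iic q)} with hA
  have hne : A.Nonempty := by
    have h := (tendsto_cdf_atTop γ).eventually (lt_mem_nhds (show 1 - α < 1 by linarith [hα.1]))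
    obtain ⟨x, hx⟩ := h.exists
    rw [cdf_eq_real] at hx
    exact ⟨x, hx.le⟩
  have hbdd : BddBelow A := by
    have h := (tendsto_cdf_atBot γ).eventually (gt_mem_nhds (show 0 < 1 - α by linarith [hα.2]))
    obtain ⟨x, hx⟩ := h.exists
    rw [cdf_eq_real] at hx
    refine ⟨x, fun y hy => ?_⟩
    by_contra hcon
    have : γ.real (Set.Iic y) ≤ γ.real (Set.Iic x) :=
      measureReal_mono (Set.Iic_subset_Iic.2 (not_le.1 hcon).le)
    have hy' : 1 - α ≤ γ.real (Set.Iic y) := hy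
    linarith
  -- The infimum is attained by right-continuity of the distribution function.
  have h1 : 1 - α ≤ cdf γ q := by
    have ht : Tendsto (cdf γ) (𝓝[>] q) (𝓝 (cdf γ q)) :=
      ((cdf γ).right_continuous q).mono_left (nhdsWithin_mono _ Set.Ioi_subset_Ici_self)
    refine ge_of_tendsto ht ?_
    filter_upwards [self_mem_nhdsWithin] with x hx
    obtain ⟨y, hy, hyx⟩ := exists_lt_of_csInf_lt hne (show sInf A < x from hx)
    have hy' : 1 - α ≤ γ.real (Set.Iic y) := hy
    rw [← cdf_eq_real] at hy'
    exact hy'.trans (monotone_cdf γ hyx.le)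
  -- Left of `q` the distribution function is below 1 - α, and the absence of an atom at `q` rules
  -- out a jump.
  have h2 : cdf γ q ≤ 1 - α := by
    have hl : Function.leftLim (cdf γ) q ≤ 1 - α := by
      refine le_of_tendsto ((monotone_cdf γ).tendsto_leftLim q) ?_
      filter_upwards [self_mem_nhdsWithin] with x hx
      by_contra hcon
      have : x ∈ A := by
        rw [cdf_eq_real] at hcon
        exact (not_le.1 hcon).le
      exact absurd (csInf_le hbdd this) (not_le.2 hx)
    have hs := (cdf γ).measure_singleton q
    rw [measure_cdf, hγ.continuous q] at hs
    have := ENNReal.ofReal_eq_zero.1 hs.symm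
    linarith
  have h3 : γ.real (Set.Iic q) = 1 - α := by
    rw [← cdf_eq_real]; exact le_antisymm h2 h1
  have h4 : γ.real (Set.Iio q) = 1 - α := by
    rw [← h3, ← Set.Iio_union_right, measureReal_union (by simp) (measurableSet_singleton q)]
    simp [measureReal_def, hγ.continuous q]
  rw [← Set.compl_Iio, probReal_compl_eq_one_sub measurableSet_Iio, h4]
  ring

lemma setIntegral_Ici_eq_tailMean (γ : Measure ℝ) {α : ℝ} (hα : 0 < α) :
    ∫ g in Set.Ici (upperQuantile γ α), g ∂γ = α * tailMean γ α := by
  rw [tailMean]; field_simp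

/-- The upper-tail mean of a standardized continuous law is positive. -/
lemma IsStandardScoreLaw.tailMean_pos (hγ : IsStandardScoreLaw γ) {α : ℝ}
    (hα : α ∈ Set.Ioo (0 : ℝ) 1) : 0 < tailMean γ α := by
  have := hγ.prob
  have hs := hγ.measureReal_Ici_upperQuantile hα
  set q := upperQuantile γ α with hq
  have hi := hγ.integrable_id
  have key : 0 < ∫ g in Set.Ici q, g ∂γ := by
    -- For q > 0 the tail integral is at least qα. For q < 0, mean zero makes it minus the integral
    -- below `q`, hence at least -q(1 - α). For q = 0 it could vanish only if the tail were null, as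
    -- there is no atom at 0.
    rcases lt_trichotomy q 0 with h | h | h
    · have hc : γ.real (Set.Iio q) = 1 - α := by
        rw [← Set.compl_Ici, probReal_compl_eq_one_sub measurableSet_Ici, hs]
      have h1 := integral_add_compl (μ := γ) (measurableSet_Ici (a := q)) hi
      rw [hγ.mean, Set.compl_Ici] at h1
      have h2 : ∫ g in Set.Iio q, g ∂γ ≤ ∫ _ in Set.Iio q, q ∂γ :=
        setIntegral_mono_on hi.integrableOn (integrable_const _).integrableOn measurableSet_Iio
          fun x hx => le_of_lt hx
      rw [setIntegral_const, hc, smul_eq_mul] at h2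
      nlinarith [hα.2, mul_neg_of_pos_of_neg (sub_pos.2 hα.2) h]
    · have hnn : 0 ≤ᵐ[γ.restrict (Set.Ici q)] fun g : ℝ => g := by
        filter_upwards [ae_restrict_mem measurableSet_Ici] with x hx
        rw [h] at hx
        exact hx
      refine (integral_nonneg_of_ae hnn).lt_of_ne fun h0 => ?_
      have h1 := (setIntegral_eq_zero_iff_of_nonneg_ae hnn hi.integrableOn).1 h0.symm
      have h2 : ∀ᵐ x ∂γ, x ≠ 0 := by
        rw [ae_iff]; simpa using hγ.continuous 0
      have h3 : ∀ᵐ x ∂γ.restrict (Set.Ici q), False := by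
        filter_upwards [h1, ae_restrict_of_ae h2] with x hx hx2 using hx2 hx
      have h4 : γ.restrict (Set.Ici q) = 0 := 
        ae_eq_bot.1 (Filter.eventually_false_iff_eq_bot.1 h3)
      rw [Measure.restrict_eq_zero] at h4
      rw [measureReal_def, h4] at hs
      simp only [ENNReal.toReal_zero] at hs
      linarith [hα.1]
    · have h2 : ∫ _ in Set.Ici q, q ∂γ ≤ ∫ g in Set.Ici q, g ∂γ :=
        setIntegral_mono_on (integrable_const _).integrableOn hi.integrableOn measurableSet_Ici
          fun x hx => hx
      rw [setIntegral_const, hs, smul_eq_mul] at h2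
      nlinarith [mul_pos hα.1 h]
  rw [setIntegral_Ici_eq_tailMean γ hα.1] at key
  exact pos_of_mul_pos_right key hα.1.le

lemma IsStandardScoreLaw.scoreConst_pos (hγ : IsStandardScoreLaw γ) {p α : ℝ}
    (hp : p ∈ Set.Ioo (0 : ℝ) 1) (hα : α ∈ Set.Ioo (0 : ℝ) 1) : 0 < scoreConst γ p α := by
  have h1 : 0 < 1 - p := sub_pos.2 hp.2
  have h2 := hp.1
  have h3 := hα.1
  have h4 : 0 < Real.log 2 := Real.log_pos one_lt_two
  exact mul_pos (Real.sqrt_pos.2 (by positivity)) (hγ.tailMean_pos hα)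

variable {b ε p : ℝ}

/-- The intercept is second-order close to the log-odds of the prevalence. -/
lemma IsStandardScoreLaw.abs_mean_sub_le (hγ : IsStandardScoreLaw γ)
    (hp : ∫ g, Real.sigmoid (b + ε * g) ∂γ = p) : |p - Real.sigmoid b| ≤ ε ^ 2 := by
  have := hγ.prob
  have hi := hγ.integrable_id
  have hσ := integrable_sigmoid_affine (γ := γ) b ε
  have hlin : Integrable (fun g => logisticSlope b * (ε * g)) γ := (hi.const_mul ε).const_mul _
  -- Mean zero kills the linear term, and the unit second moment turns the quadratic remainder into
  -- ε².
  have e : p - Real.sigmoid b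
      = ∫ g, (Real.sigmoid (b + ε * g) - Real.sigmoid b - logisticSlope b * (ε * g)) ∂γ := by
    rw [integral_sub (hσ.fun_sub (integrable_const _)) hlin, integral_sub hσ (integrable_const _), hp,
      integral_const_mul, integral_const_mul, hγ.mean]
    simp
  rw [e]
  refine (abs_integral_le_integral_abs).trans ?_
  have h2 : ∫ g, (ε * g) ^ 2 ∂γ = ε ^ 2 := by
    simp_rw [mul_pow]
    rw [integral_const_mul, hγ.second_moment, mul_one]
  rw [← h2]
  refine integral_mono ((hσ.fun_sub (integrable_const _)).fun_sub hlin).abs ?_ fun g =>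
    abs_sigmoid_add_sub_le b (ε * g)
  simp_rw [mul_pow]
  exact hγ.integrable_sq.const_mul _

/-- The intercept `b` varies with ε; this replaces its slope by the fixed p(1 - p), since the slope
is a 1-Lipschitz function of σ(b). -/
lemma IsStandardScoreLaw.abs_slope_sub_le (hγ : IsStandardScoreLaw γ)
    (hp : ∫ g, Real.sigmoid (b + ε * g) ∂γ = p) (hp01 : p ∈ Set.Ioo (0 : ℝ) 1) :
    |logisticSlope b - p * (1 - p)| ≤ ε ^ 2 := by
  obtain ⟨c, hc⟩ := exists_sigmoid_eq hp01
  have h1 := hγ.abs_mean_sub_le hp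
  have h2 := abs_logisticSlope_sub_le_sigmoid b c
  rw [hc, abs_sub_comm _ p] at h2
  refine le_trans ?_ (h2.trans h1)
  rw [logisticSlope, logisticSlope, hc]

/-- Upper bound for the screening information in the weak-screening regime. -/
lemma IsStandardScoreLaw.integral_bernoulliDiv_le (hγ : IsStandardScoreLaw γ) (hε : 0 ≤ ε)
    (hp : ∫ g, Real.sigmoid (b + ε * g) ∂γ = p) (hp01 : p ∈ Set.Ioo (0 : ℝ) 1) :
    ∫ g, bernoulliDiv (Real.sigmoid (b + ε * g)) p ∂γ
      ≤ logisticSlope b / 2 * ε ^ 2 + ε ^ 3 * ∫ g, |g| ^ 3 ∂γ := by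
  have := hγ.prob
  obtain ⟨c, hc⟩ := exists_sigmoid_eq hp01
  set r := Real.sigmoid b with hr
  have hσ := integrable_sigmoid_affine (γ := γ) b ε
  have hdiv := integrable_bernoulliDiv_sigmoid (γ := γ) b ε r
  -- Changing the reference from `r` to `p` adds an affine function of `x`. Because the score has
  -- mean `p`, it integrates to -D(p‖r) ≤ 0, so the divergence may be expanded around σ(b) instead
  -- of around `p`.
  have e : ∀ x : ℝ, bernoulliDiv x p = bernoulliDiv x r
      + (x * (Real.log r - Real.log p - (Real.log (1 - r) - Real.log (1 - p)))
        + (Real.log (1 - r) - Real.log (1 - p))) := by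
    intro x; unfold bernoulliDiv; ring
  have h1 : ∫ g, bernoulliDiv (Real.sigmoid (b + ε * g)) p ∂γ
      = ∫ g, bernoulliDiv (Real.sigmoid (b + ε * g)) r ∂γ - bernoulliDiv p r := by
    simp_rw [e (Real.sigmoid _)]
    rw [integral_add hdiv ((hσ.mul_const _).fun_add (integrable_const _)),
      integral_add (hσ.mul_const _) (integrable_const _), integral_mul_const, hp]
    simp only [integral_const, probReal_univ, one_smul, bernoulliDiv]
    ring
  have h2 : 0 ≤ bernoulliDiv p r := by rw [← hc]; exact bernoulliDiv_nonneg c b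
  have hsq := hγ.integrable_sq
  have h3 : ∫ g, bernoulliDiv (Real.sigmoid (b + ε * g)) r ∂γ
      ≤ ∫ g, (logisticSlope b / 2 * ε ^ 2 * g ^ 2 + ε ^ 3 * |g| ^ 3) ∂γ := by
    refine integral_mono hdiv ((hsq.const_mul _).fun_add (hγ.third_moment.const_mul _)) fun g => ?_
    refine (bernoulliDiv_sigmoid_add_le b (ε * g)).trans (le_of_eq ?_)
    rw [abs_mul, abs_of_nonneg hε]
    ring
  rw [integral_add (hsq.const_mul _) (hγ.third_moment.const_mul _), integral_const_mul,
    integral_const_mul, hγ.second_moment] at h3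
  linarith

/-- Lower bound for the variance of the score in the weak-screening regime. -/
lemma IsStandardScoreLaw.sq_le_integral_sq (hγ : IsStandardScoreLaw γ)
    (ht : 0 ≤ logisticSlope b * ε - ε ^ 2 * ∫ g, |g| ^ 3 ∂γ) :
    (logisticSlope b * ε - ε ^ 2 * ∫ g, |g| ^ 3 ∂γ) ^ 2
      ≤ ∫ g, (Real.sigmoid (b + ε * g) - p) ^ 2 ∂γ := by
  have := hγ.prob
  set t := logisticSlope b * ε - ε ^ 2 * ∫ g, |g| ^ 3 ∂γ with htdef
  have hi := hγ.integrable_id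
  have hsq := hγ.integrable_sq
  have h3 := hγ.third_moment
  have hV := integrable_sq_sigmoid_sub (γ := γ) b ε p
  -- This is 2t g y - t² g² ≤ y² with y the centred score. The offset term integrates to zero by
  -- mean zero, and what remains is 2t · t - t² = t².
  have hpt : ∀ g : ℝ, 2 * t * (logisticSlope b * ε * g ^ 2 - ε ^ 2 * |g| ^ 3
      + (Real.sigmoid b - p) * g) - t ^ 2 * g ^ 2 ≤ (Real.sigmoid (b + ε * g) - p) ^ 2 := by
    intro g
    have h1 := abs_sigmoid_add_sub_le b (ε * g)
    have h2 : logisticSlope b * ε * g ^ 2 - ε ^ 2 * |g| ^ 3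
        ≤ (Real.sigmoid (b + ε * g) - Real.sigmoid b) * g := by
      have h4 : |(Real.sigmoid (b + ε * g) - Real.sigmoid b - logisticSlope b * (ε * g)) * g|
          ≤ (ε * g) ^ 2 * |g| := by
        rw [abs_mul]; gcongr
      have h5 : (ε * g) ^ 2 * |g| = ε ^ 2 * |g| ^ 3 := by
        rw [mul_pow, ← sq_abs g]; ring
      have h6 := (abs_le.1 h4).1
      nlinarith
    nlinarith [sq_nonneg (Real.sigmoid (b + ε * g) - p - t * g),
      mul_le_mul_of_nonneg_left h2 ht]
  have hL : Integrable (fun g : ℝ => logisticSlope b * ε * g ^ 2 - ε ^ 2 * |g| ^ 3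
      + (Real.sigmoid b - p) * g) γ :=
    ((hsq.const_mul _).fun_sub (h3.const_mul _)).fun_add (hi.const_mul _)
  have h := integral_mono ((hL.const_mul (2 * t)).fun_sub (hsq.const_mul (t ^ 2))) hV hpt
  refine le_trans (le_of_eq ?_) h
  rw [integral_sub (hL.const_mul _) (hsq.const_mul _), integral_const_mul, integral_const_mul,
    integral_add ((hsq.const_mul _).fun_sub (h3.const_mul _)) (hi.const_mul _),
    integral_sub (hsq.const_mul _) (h3.const_mul _), integral_const_mul, integral_const_mul,
    integral_const_mul, hγ.mean, hγ.second_moment]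
  have : logisticSlope b * ε * 1 - ε ^ 2 * ∫ g, |g| ^ 3 ∂γ = t := by rw [htdef]; ring
  rw [this]
  ring

/-- Expected excess of the score over the threshold at the upper quantile. -/
lemma IsStandardScoreLaw.le_integral_max (hγ : IsStandardScoreLaw γ) {α : ℝ}
    (hα : α ∈ Set.Ioo (0 : ℝ) 1) :
    logisticSlope b * ε * α * (tailMean γ α - upperQuantile γ α)
        - ε ^ 2 * (1 + upperQuantile γ α ^ 2)
      ≤ ∫ g, max (Real.sigmoid (b + ε * g) - Real.sigmoid (b + ε * upperQuantile γ α)) 0 ∂γ := by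
  have := hγ.prob
  have hs := hγ.measureReal_Ici_upperQuantile hα
  have htm := setIntegral_Ici_eq_tailMean γ hα.1
  set q := upperQuantile γ α with hq
  have hi := hγ.integrable_id
  have hsq := hγ.integrable_sq
  have hσ := integrable_sigmoid_affine (γ := γ) b ε
  have hmax : Integrable (fun g => max (Real.sigmoid (b + ε * g) - Real.sigmoid (b + ε * q)) 0) γ :=
    (hσ.fun_sub (integrable_const _)).pos_part
  have hind : Integrable ((Set.Ici q).indicator fun g : ℝ => g - q) γ :=
    (hi.fun_sub (integrable_const _)).indicator measurableSet_Ici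
  -- Above the quantile both logistic values are expanded at `b`; below it the left side is
  -- nonpositive.
  have hpt : ∀ g : ℝ, logisticSlope b * ε * (Set.Ici q).indicator (fun g : ℝ => g - q) g
      - ε ^ 2 * (g ^ 2 + q ^ 2)
      ≤ max (Real.sigmoid (b + ε * g) - Real.sigmoid (b + ε * q)) 0 := by
    intro g
    by_cases hg : g ∈ Set.Ici q
    · rw [Set.indicator_of_mem hg]
      refine le_trans ?_ (le_max_left _ _)
      have h1 := (abs_le.1 (abs_sigmoid_add_sub_le b (ε * g))).1
      have h2 := (abs_le.1 (abs_sigmoid_add_sub_le b (ε * q))).2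
      nlinarith
    · rw [Set.indicator_of_notMem hg]
      refine le_trans ?_ (le_max_right _ _)
      have : 0 ≤ ε ^ 2 * (g ^ 2 + q ^ 2) := by positivity
      linarith
  have h := integral_mono ((hind.const_mul (logisticSlope b * ε)).fun_sub
    ((hsq.fun_add (integrable_const (q ^ 2))).const_mul (ε ^ 2))) hmax hpt
  refine le_trans (le_of_eq ?_) h
  rw [integral_sub (hind.const_mul _) ((hsq.fun_add (integrable_const _)).const_mul _),
    integral_const_mul, integral_indicator measurableSet_Ici,
    integral_sub hi.integrableOn (integrable_const _).integrableOn, htm, setIntegral_const, hs,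
    integral_const_mul]
  have e : ∫ g : ℝ, (g ^ 2 + q ^ 2) ∂γ = 1 + q ^ 2 := by
    rw [integral_add hsq (integrable_const _), hγ.second_moment]
    simp
  rw [e, smul_eq_mul]
  ring

lemma IsStandardScoreLaw.integral_sq_sub_le (hγ : IsStandardScoreLaw γ) (q : ℝ) :
    ∫ g, (Real.sigmoid (b + ε * g) - Real.sigmoid (b + ε * q)) ^ 2 ∂γ ≤ ε ^ 2 * (1 + q ^ 2) := by
  have := hγ.prob
  have hi := hγ.integrable_id
  have hsq := hγ.integrable_sq
  have hb : Integrable (fun g : ℝ => ε ^ 2 * (g ^ 2 - 2 * q * g + q ^ 2)) γ :=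
    ((hsq.fun_sub (hi.const_mul _)).fun_add (integrable_const _)).const_mul _
  refine (integral_mono (integrable_sq_sigmoid_sub b ε _) hb fun g => ?_).trans (le_of_eq ?_)
  · have h1 := abs_sigmoid_sub_le (b + ε * g) (b + ε * q)
    have h2 : |Real.sigmoid (b + ε * g) - Real.sigmoid (b + ε * q)| ≤ |ε * g - ε * q| := by
      rw [show b + ε * g - (b + ε * q) = ε * g - ε * q by ring] at h1
      linarith [abs_nonneg (ε * g - ε * q)]
    refine (sq_le_sq.2 h2).trans (le_of_eq ?_)
    ring
  · rw [integral_const_mul, integral_add (hsq.fun_sub (hi.const_mul _)) (integrable_const _),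
      integral_sub hsq (hi.const_mul _), integral_const_mul, hγ.mean, hγ.second_moment]
    simp

end StandardScore

end Haystack

/-! ### Achievability: the threshold policy -/

namespace Haystack

/-- A `B`-element selection comparable with a given one. -/
lemma exists_selection {K B : ℕ} (hB : B ≤ K) (A : Fin K → Bool) :
    ∃ S : Fin K → Bool, (Finset.univ.filter fun i => S i = true).card = B ∧
      ((∀ i, S i = true → A i = true) ∨ ∀ i, A i = true → S i = true) := by
  set a := Finset.univ.filter fun i => A i = true with ha
  have of_finset : ∀ s : Finset (Fin K), s.card = B → (s ⊆ a ∨ a ⊆ s) →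
      ∃ S : Fin K → Bool, (Finset.univ.filter fun i => S i = true).card = B ∧
      ((∀ i, S i = true → A i = true) ∨ ∀ i, A i = true → S i = true) := by
    intro s hs h
    refine ⟨fun i => decide (i ∈ s), by simpa using hs, ?_⟩
    rcases h with h | h
    · left
      intro i hi
      simpa [ha] using h (of_decide_eq_true hi)
    · right
      intro i hi
      exact decide_eq_true (h (by simpa [ha] using hi))
  rcases le_total B a.card with h | h
  · obtain ⟨s, hs, hc⟩ := Finset.exists_subset_card_eq h
    exact of_finset s hc (Or.inl hs)
  · obtain ⟨s, hs, hc⟩ := Finset.exists_superset_card_eq h (by simpa using hB)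
    exact of_finset s hc (Or.inr hs)

/-- A `B`-element selection comparable with `A`. -/
def comparableSelection {K B : ℕ} (hB : B ≤ K) (A : Fin K → Bool) : Fin K → Bool :=
  (exists_selection hB A).choose

lemma card_comparableSelection {K B : ℕ} (hB : B ≤ K) (A : Fin K → Bool) :
    (Finset.univ.filter fun i => comparableSelection hB A i = true).card = B :=
  (exists_selection hB A).choose_spec.1

lemma comparableSelection_comparable {K B : ℕ} (hB : B ≤ K) (A : Fin K → Bool) :
    (∀ i, comparableSelection hB A i = true → A i = true) ∨
      ∀ i, A i = true → comparableSelection hB A i = true :=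
  (exists_selection hB A).choose_spec.2

/-- The sum over a selection of prescribed size comparable with the set of nonnegative values. -/
lemma sum_max_le_sum_selection {K B : ℕ} (y : Fin K → ℝ) (S : Fin K → Bool)
    (hcard : (Finset.univ.filter fun i => S i = true).card = B)
    (hcomp : (∀ i, S i = true → 0 ≤ y i) ∨ ∀ i, 0 ≤ y i → S i = true) {t : ℝ} (ht : 0 < t) :
    ∑ i, max (y i) 0 - t * |(∑ i, if 0 ≤ y i then (1 : ℝ) else 0) - B| - (∑ i, y i ^ 2) / t
      ≤ ∑ i, if S i = true then y i else 0 := by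
  have hB : (B : ℝ) = ∑ i, if S i = true then (1 : ℝ) else 0 := by
    rw [Finset.sum_boole, hcard]
  -- This prices a wrongly included or excluded record: |y| ≤ t + y²/t. As the selection and the set
  -- of nonnegative values are nested, the number of such records is exactly the discrepancy between
  -- the two cardinalities.
  have hsmall : ∀ x : ℝ, |x| ≤ t + x ^ 2 / t := by
    intro x
    rw [← sub_nonneg]
    have : t + x ^ 2 / t - |x| = ((|x| - t / 2) ^ 2 + 3 / 4 * t ^ 2) / t := by
      rw [← sq_abs x]; field_simp; ring
    rw [this]; positivity
  rcases hcomp with h | h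
  · have hpt : ∀ i ∈ Finset.univ, max (y i) 0 - t * ((if 0 ≤ y i then (1 : ℝ) else 0)
        - if S i = true then (1 : ℝ) else 0) - y i ^ 2 / t ≤ if S i = true then y i else 0 := by
      intro i _
      have hq : 0 ≤ y i ^ 2 / t := by positivity
      have h1 := hsmall (y i)
      by_cases hS : S i = true
      · simp [hS, h i hS, hq]
      · by_cases hy : 0 ≤ y i
        · rw [abs_of_nonneg hy] at h1
          simp [hS, hy]; linarith
        · simp [hS, hy, (not_le.1 hy).le, hq]
    have h2 := Finset.sum_le_sum hpt
    rw [Finset.sum_sub_distrib, Finset.sum_sub_distrib, ← Finset.mul_sum,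
      Finset.sum_sub_distrib, ← hB, ← Finset.sum_div] at h2
    have h3 := mul_le_mul_of_nonneg_left
      (le_abs_self ((∑ i, if 0 ≤ y i then (1 : ℝ) else 0) - B)) ht.le
    linarith
  · have hpt : ∀ i ∈ Finset.univ, max (y i) 0 - t * ((if S i = true then (1 : ℝ) else 0)
        - if 0 ≤ y i then (1 : ℝ) else 0) - y i ^ 2 / t ≤ if S i = true then y i else 0 := by
      intro i _
      have hq : 0 ≤ y i ^ 2 / t := by positivity
      have h1 := hsmall (y i)
      by_cases hy : 0 ≤ y i
      · simp [h i hy, hy, hq]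
      · rw [abs_of_neg (not_le.1 hy)] at h1
        by_cases hS : S i = true
        · simp [hS, hy, (not_le.1 hy).le]; linarith
        · simp [hS, hy, (not_le.1 hy).le, hq]
    have h2 := Finset.sum_le_sum hpt
    rw [Finset.sum_sub_distrib, Finset.sum_sub_distrib, ← Finset.mul_sum,
      Finset.sum_sub_distrib, ← hB, ← Finset.sum_div] at h2
    have h3 := mul_le_mul_of_nonneg_left
      (neg_abs_le ((∑ i, if 0 ≤ y i then (1 : ℝ) else 0) - B)) ht.le
    linarith

section Threshold

variable {𝒵 : Type*} [MeasurableSpace 𝒵] {K B : ℕ}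

/-- The `B` records selected by thresholding the score at `τ` and then adjusting the size. -/
def thresholdSelection (R : Measure (Bool × 𝒵)) [IsProbabilityMeasure R] (hB : B ≤ K) (τ : ℝ)
    (z : Fin K → 𝒵) : Fin K → Bool :=
  comparableSelection hB fun i => decide (τ ≤ bayesScore R (z i))

variable (R : Measure (Bool × 𝒵)) [IsProbabilityMeasure R] (hB : B ≤ K) (τ : ℝ)

lemma measurable_thresholdSelection : Measurable (thresholdSelection R hB τ) := by
  have h : Measurable fun z : Fin K → 𝒵 => fun i => decide (τ ≤ bayesScore R (z i)) := by
    refine measurable_pi_iff.2 fun i => ?_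
    refine measurable_to_bool ?_
    have : (fun z : Fin K → 𝒵 => decide (τ ≤ bayesScore R (z i))) ⁻¹' {true}
        = {z | τ ≤ bayesScore R (z i)} := by ext; simp
    rw [this]
    exact measurableSet_le measurable_const ((measurable_bayesScore R).comp (measurable_pi_apply i))
  -- The adjustment is an arbitrary choice, but its domain is finite and discrete, so measurability
  -- is automatic.
  exact (measurable_of_countable (comparableSelection hB)).comp h

/-- The policy that verifies the `B` records selected by thresholding the score. -/
def thresholdPolicy : Policy 𝒵 K B where
  select := Kernel.deterministic (thresholdSelection R hB τ) (measurable_thresholdSelection R hB τ)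
  isMarkov := inferInstance
  budget z := by
    rw [Kernel.deterministic_apply, ae_dirac_eq]
    exact (card_comparableSelection hB _).le

lemma thresholdPolicy_select_real (z : Fin K → 𝒵) (i : Fin K) :
    ((thresholdPolicy R hB τ).select z).real {S | S i = true}
      = if thresholdSelection R hB τ z i = true then 1 else 0 := by
  rw [thresholdPolicy, measureReal_def, Kernel.deterministic_apply,
    Measure.dirac_apply' _ (Set.toFinite _).measurableSet]
  by_cases h : thresholdSelection R hB τ z i = true <;> simp [h]

lemma integrable_eval_pi {ψ : 𝒵 → ℝ} (hψ : Integrable ψ R.snd) (i : Fin K) :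
    Integrable (fun z : Fin K → 𝒵 => ψ (z i)) (Measure.pi fun _ => R.snd) :=
  (measurePreserving_eval (fun _ : Fin K => R.snd) i).integrable_comp_of_integrable hψ

lemma integral_sum_eval_pi {ψ : 𝒵 → ℝ} (hψ : Integrable ψ R.snd) :
    ∫ z : Fin K → 𝒵, ∑ i, ψ (z i) ∂Measure.pi (fun _ => R.snd) = K * ∫ z, ψ z ∂(R.snd) := by
  rw [integral_finsetSum _ fun i _ => integrable_eval_pi R hψ i]
  simp_rw [integral_comp_eval (μ := fun _ : Fin K => R.snd) hψ.aestronglyMeasurable]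
  simp

/-- Pointwise lower bound for the threshold policy, integrated. -/
lemma le_expectedHits_thresholdPolicy {t : ℝ} (ht : 0 < t) :
    B * τ + K * ∫ z, max (bayesScore R z - τ) 0 ∂(R.snd)
        - t * ∫ z : Fin K → 𝒵, |(∑ i, if τ ≤ bayesScore R (z i) then (1 : ℝ) else 0) - B|
            ∂Measure.pi (fun _ => R.snd)
        - K * (∫ z, (bayesScore R z - τ) ^ 2 ∂(R.snd)) / t
      ≤ expectedHits R (thresholdPolicy R hB τ) := by
  have hη := measurable_bayesScore R
  have hmax : Integrable (fun z => max (bayesScore R z - τ) 0) R.snd := by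
    refine integrable_comp_bayesScore (φ := fun x => max (x - τ) 0) (by fun_prop)
      (C := 1 + |τ|) fun x hx => ?_
    rw [abs_of_nonneg (le_max_right _ _)]
    exact max_le (by linarith [hx.2, neg_abs_le τ]) (by positivity)
  have hsq : Integrable (fun z => (bayesScore R z - τ) ^ 2) R.snd := by
    refine integrable_comp_bayesScore (φ := fun x => (x - τ) ^ 2) (by fun_prop)
      (C := (1 + |τ|) ^ 2) fun x hx => ?_
    rw [abs_of_nonneg (sq_nonneg _), ← sq_abs]
    gcongr
    rw [abs_le]; constructor <;> linarith [hx.1, hx.2, neg_abs_le τ, le_abs_self τ]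
  have hcount : Integrable (fun z : Fin K → 𝒵 =>
      |(∑ i, if τ ≤ bayesScore R (z i) then (1 : ℝ) else 0) - B|)
      (Measure.pi fun _ => R.snd) := by
    refine Integrable.abs (Integrable.fun_sub (integrable_finsetSum _ fun i _ => ?_)
      (integrable_const _))
    refine integrable_eval_pi R (ψ := fun z => if τ ≤ bayesScore R z then (1 : ℝ) else 0) ?_ i
    refine integrable_comp_bayesScore (φ := fun x => if τ ≤ x then (1 : ℝ) else 0)
      (Measurable.ite measurableSet_Ici measurable_const measurable_const) (C := 1) fun x _ => ?_
    split_ifs <;> simp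
  have hsm := integrable_finsetSum Finset.univ fun i _ => integrable_eval_pi (K := K) R hmax i
  have hss := integrable_finsetSum Finset.univ fun i _ => integrable_eval_pi (K := K) R hsq i
  have hpt : ∀ z : Fin K → 𝒵, B * τ + ∑ i, max (bayesScore R (z i) - τ) 0
      - t * |(∑ i, if τ ≤ bayesScore R (z i) then (1 : ℝ) else 0) - B|
      - (∑ i, (bayesScore R (z i) - τ) ^ 2) / t
      ≤ ∑ i, ((thresholdPolicy R hB τ).select z).real {S | S i = true} * bayesScore R (z i) := by
    intro z
    have hcard : (Finset.univ.filter fun i => thresholdSelection R hB τ z i = true).card = B :=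
      card_comparableSelection hB _
    have h := sum_max_le_sum_selection (fun i => bayesScore R (z i) - τ)
      (thresholdSelection R hB τ z) hcard (by
        simpa [thresholdSelection] using comparableSelection_comparable hB
          fun i => decide (τ ≤ bayesScore R (z i))) ht
    simp only [sub_nonneg] at h
    -- Exactly `B` records are selected, so centring the scores at `τ` costs exactly `B τ`.
    have e : ∑ i, (if thresholdSelection R hB τ z i = true then bayesScore R (z i) - τ else 0)
        = ∑ i, ((thresholdPolicy R hB τ).select z).real {S | S i = true} * bayesScore R (z i)
          - B * τ := by
      have hBs : (B : ℝ) = ∑ i, if thresholdSelection R hB τ z i = true then (1 : ℝ) else 0 := by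
        rw [Finset.sum_boole, hcard]
      rw [hBs, Finset.sum_mul, ← Finset.sum_sub_distrib]
      refine Finset.sum_congr rfl fun i _ => ?_
      rw [thresholdPolicy_select_real]
      split_ifs <;> ring
    linarith
  have hint := integral_mono
    ((((integrable_const _).fun_add hsm).fun_sub (hcount.const_mul t)).fun_sub (hss.div_const t))
    (integrable_finsetSum _ fun i _ => integrable_hits R (thresholdPolicy R hB τ) i) hpt
  rw [integral_sub (((integrable_const _).fun_add hsm).fun_sub (hcount.const_mul t))
    (hss.div_const t), integral_sub ((integrable_const _).fun_add hsm) (hcount.const_mul t),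
    integral_add (integrable_const _) hsm, integral_const_mul t, integral_div,
    integral_sum_eval_pi R hmax, integral_sum_eval_pi R hsq] at hint
  simpa [expectedHits] using hint

/-- The number of records above the threshold concentrates around its mean. -/
lemma integral_abs_count_sub_le {α : ℝ} (hα : (R.snd).real {z | τ ≤ bayesScore R z} = α)
    (hBα : |α * K - B| ≤ 1) {s : ℝ} (hs : 0 < s) (hsK : s ^ 2 = K) :
    ∫ z : Fin K → 𝒵, |(∑ i, if τ ≤ bayesScore R (z i) then (1 : ℝ) else 0) - B|
      ∂Measure.pi (fun _ => R.snd) ≤ 1 + 2 * s := by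
  set X : 𝒵 → ℝ := fun z => if τ ≤ bayesScore R z then (1 : ℝ) else 0 with hX
  have hXm : Measurable X := Measurable.ite
    (measurableSet_le measurable_const (measurable_bayesScore R)) measurable_const measurable_const
  have hXb : ∀ z, ‖X z‖ ≤ 1 := fun z => by simp only [hX]; split_ifs <;> simp
  have hXL : MemLp X 2 R.snd := MemLp.of_bound hXm.aestronglyMeasurable 1 (ae_of_all _ hXb)
  have hXi : Integrable X R.snd := hXL.integrable (by norm_num)
  have hXmean : ∫ z, X z ∂(R.snd) = α := by
    rw [← hα, ← integral_indicator_one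
      (measurableSet_le measurable_const (measurable_bayesScore R))]
    refine integral_congr_ae (ae_of_all _ fun z => ?_)
    simp [hX, Set.indicator_apply]
  set π : Measure (Fin K → 𝒵) := Measure.pi fun _ => R.snd with hπ
  have hmean : ∫ z, ∑ i, X (z i) ∂π = α * K := by
    rw [hπ, integral_sum_eval_pi R hXi, hXmean, mul_comm]
  have hvar1 : Var[X; R.snd] ≤ 1 := by
    refine (variance_le_expectation_sq hXm.aestronglyMeasurable).trans ?_
    have : ∫ z, (X ^ 2) z ∂(R.snd) ≤ ∫ _, (1 : ℝ) ∂(R.snd) := by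
      refine integral_mono hXL.integrable_sq (integrable_const _) fun z => ?_
      simp only [Pi.pow_apply]
      rw [← sq_abs, ← Real.norm_eq_abs]
      exact pow_le_one₀ (norm_nonneg _) (hXb z)
    simpa using this
  have hvar : ∫ z, ((∑ i, X (z i)) - α * K) ^ 2 ∂π ≤ K := by
    have h := variance_sum_pi (ι := Fin K) (μ := fun _ => R.snd) (X := fun _ => X) fun _ => hXL
    have hsum : (∑ i : Fin K, fun z : Fin K → 𝒵 => X (z i)) = fun z => ∑ i, X (z i) := by
      ext z; simp
    have hNm : Measurable fun z : Fin K → 𝒵 => ∑ i, X (z i) :=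
      Finset.measurable_sum _ fun i _ => hXm.comp (measurable_pi_apply i)
    rw [hsum, variance_eq_integral hNm.aemeasurable, ← hπ, hmean] at h
    rw [h]
    calc _ ≤ ∑ i : Fin K, (1 : ℝ) := Finset.sum_le_sum fun _ _ => hvar1
      _ = K := by simp
  have hNi : Integrable (fun z => ∑ i, X (z i)) π :=
    integrable_finsetSum _ fun i _ => integrable_eval_pi R hXi i
  have hsqi : Integrable (fun z => ((∑ i, X (z i)) - α * K) ^ 2) π := by
    have hm : MemLp (fun z => ∑ i, X (z i)) 2 π := by
      refine memLp_finsetSum _ fun i _ => ?_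
      exact hXL.comp_measurePreserving (measurePreserving_eval (fun _ : Fin K => R.snd) i)
    exact (hm.sub (memLp_const (α * K))).integrable_sq
  -- With s = √K the two terms s and x²/s balance, as the count has variance at most `K`; the extra
  -- 1 covers the rounding of `B`.
  have hpt : ∀ z : Fin K → 𝒵, |(∑ i, X (z i)) - B|
      ≤ 1 + s + ((∑ i, X (z i)) - α * K) ^ 2 / s := by
    intro z
    set x := (∑ i, X (z i)) - α * K with hx
    have h1 : |x| ≤ s + x ^ 2 / s := by
      rw [← sub_nonneg]
      have : s + x ^ 2 / s - |x| = ((|x| - s / 2) ^ 2 + 3 / 4 * s ^ 2) / s := by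
        rw [← sq_abs x]; field_simp; ring
      rw [this]; positivity
    have h2 : (∑ i, X (z i)) - B = x + (α * K - B) := by rw [hx]; ring
    rw [h2]
    linarith [abs_add_le x (α * K - B)]
  have h := integral_mono (hNi.fun_sub (integrable_const (B : ℝ))).abs
    ((integrable_const (1 + s)).fun_add (hsqi.div_const s)) hpt
  rw [integral_add (integrable_const _) (hsqi.div_const s), integral_div] at h
  have h3 : (∫ z, ((∑ i, X (z i)) - α * K) ^ 2 ∂π) / s ≤ s := by
    rw [div_le_iff₀ hs, ← sq, hsK]; exact hvar
  simp only [integral_const, probReal_univ, one_smul] at h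
  linarith

end Threshold

/-- The threshold policy in the weak-screening regime. -/
theorem exists_policy_weak_screening {𝒵 : Type*} [MeasurableSpace 𝒵] {R : Measure (Bool × 𝒵)}
    [IsProbabilityMeasure R] {γ : Measure ℝ} (hγ : IsStandardScoreLaw γ) {b ε p α : ℝ}
    (hscore : HasLogOddsScore R γ b ε) (hε : 0 ≤ ε) (hp : R.fst.real {true} = p)
    (hα : α ∈ Set.Ioo (0 : ℝ) 1) {K B : ℕ} (hB : B = ⌊α * (K : ℝ)⌋₊) {k : ℝ} (hk : 1 ≤ k)
    (hkK : k ^ 4 = K) :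
    ∃ P : Policy 𝒵 K B,
      B * p + ε * K * (logisticSlope b * (α * tailMean γ α)
          - (5 + 2 * upperQuantile γ α ^ 2) * (ε + 1 / k)) ≤ expectedHits R P := by
  have := hγ.prob
  set q := upperQuantile γ α with hq
  have hK0 : (0 : ℝ) ≤ K := Nat.cast_nonneg K
  have hαK : 0 ≤ α * (K : ℝ) := mul_nonneg hα.1.le hK0
  have hB1 : (B : ℝ) ≤ α * K := by rw [hB]; exact Nat.floor_le hαK
  have hB2 : α * K < B + 1 := by rw [hB]; exact Nat.lt_floor_add_one _
  have hBK : B ≤ K := by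
    have : (B : ℝ) ≤ K := hB1.trans (mul_le_of_le_one_left hK0 hα.2.le)
    exact_mod_cast this
  have hpσ : ∫ g, Real.sigmoid (b + ε * g) ∂γ = p := by
    rw [← hp, ← integral_bayesScore]
    exact (integral_comp_bayesScore hscore measurable_id).symm
  set τ := Real.sigmoid (b + ε * q) with hτ
  refine ⟨thresholdPolicy R hBK τ, ?_⟩
  have hV : ∫ z, (bayesScore R z - τ) ^ 2 ∂(R.snd) ≤ ε ^ 2 * (1 + q ^ 2) := by
    rw [integral_comp_bayesScore hscore (φ := fun x => (x - τ) ^ 2) (by fun_prop)]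
    exact hγ.integral_sq_sub_le q
  have hM : logisticSlope b * ε * α * (tailMean γ α - q) - ε ^ 2 * (1 + q ^ 2)
      ≤ ∫ z, max (bayesScore R z - τ) 0 ∂(R.snd) := by
    rw [integral_comp_bayesScore hscore (φ := fun x => max (x - τ) 0) (by fun_prop)]
    exact hγ.le_integral_max hα
  set N := ∫ z : Fin K → 𝒵, |(∑ i, if τ ≤ bayesScore R (z i) then (1 : ℝ) else 0) - B|
    ∂Measure.pi (fun _ => R.snd) with hN
  have hpol := fun t ht => le_expectedHits_thresholdPolicy R hBK τ (t := t) ht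
  rw [← hN] at hpol
  set E := expectedHits R (thresholdPolicy R hBK τ)
  set V := ∫ z, (bayesScore R z - τ) ^ 2 ∂(R.snd)
  set M := ∫ z, max (bayesScore R z - τ) 0 ∂(R.snd)
  -- At ε = 0 the score is almost surely constant, so its threshold event need not have probability
  -- α. But then `V = 0`, and the count penalty is made arbitrarily small by shrinking `t`.
  rcases hε.eq_or_lt with h0 | hε
  · have hpb : p = τ := by
      have h1 := hγ.abs_mean_sub_le hpσ
      rw [← h0, zero_pow two_ne_zero, abs_nonpos_iff] at h1
      rw [hτ, ← h0]
      simp only [zero_mul, add_zero]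
      linarith
    rw [← h0] at hM hV
    have hV0 : V = 0 := le_antisymm (by simpa using hV) (integral_nonneg fun z => sq_nonneg _)
    have hM0 : 0 ≤ M := integral_nonneg fun z => le_max_right _ _
    rw [← h0, hpb]
    simp only [zero_mul, add_zero]
    refine le_of_forall_pos_le_add fun δ hδ => ?_
    have hN0 : 0 ≤ N := integral_nonneg fun z => abs_nonneg _
    have h := hpol (δ / (N + 1)) (by positivity)
    rw [hV0, mul_zero, zero_div, sub_zero] at h
    have h2 : δ / (N + 1) * N ≤ δ := by
      rw [div_mul_eq_mul_div, div_le_iff₀ (by positivity)]; nlinarith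
    nlinarith [mul_nonneg hK0 hM0]
  · have hcount : (R.snd).real {z | τ ≤ bayesScore R z} = α := by
      have h1 : (R.snd).real {z | τ ≤ bayesScore R z}
          = ((R.snd).map (bayesScore R)).real (Set.Ici τ) := by
        rw [measureReal_def, measureReal_def,
          Measure.map_apply (measurable_bayesScore R) measurableSet_Ici]
        rfl
      rw [h1, map_bayesScore hscore, measureReal_def,
        Measure.map_apply (measurable_sigmoid_affine b ε) measurableSet_Ici,
        ← hγ.measureReal_Ici_upperQuantile hα, measureReal_def]
      congr 2
      ext g
      simp only [Set.mem_preimage, Set.mem_Ici, hτ, Real.sigmoid_le_iff, add_le_add_iff_left]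
      exact mul_le_mul_iff_right₀ hε
    have hk0 : 0 < k := by linarith
    have hNle : N ≤ 1 + 2 * k ^ 2 := integral_abs_count_sub_le R τ hcount
      (by rw [abs_le]; constructor <;> linarith) (s := k ^ 2) (by positivity) (by rw [← hkK]; ring)
    -- With k = K^(1/4), the choice t = εk balances the penalties: t · √K and K ε²/t are both of
    -- order εk³ = εK/k.
    have h := hpol (ε * k) (by positivity)
    have hsl := logisticSlope_pos b
    have hsl1 := logisticSlope_le b
    have hm1 := (abs_le.1 (hγ.abs_mean_sub_le hpσ)).2
    have ht1 := (abs_le.1 (abs_sigmoid_add_sub_le b (ε * q))).1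
    rw [← hτ] at ht1
    -- The threshold exceeds `p` by about slope · εq. Replacing `B` by αK, this contributes the αq
    -- that cancels the -αq in the lower bound for the mean excess `M`.
    have hBτ : B * p + (α * K * (logisticSlope b * ε * q) - ε * (1 + q ^ 2))
        - K * (ε ^ 2 * (1 + q ^ 2)) ≤ B * τ := by
      have h1 : logisticSlope b * ε * q - ε ^ 2 * (1 + q ^ 2) ≤ τ - p := by linarith only [hm1, ht1]
      have h2 := mul_le_mul_of_nonneg_left h1 (Nat.cast_nonneg (α := ℝ) B)
      have h3 : α * K * (logisticSlope b * ε * q) - ε * (1 + q ^ 2)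
          ≤ B * (logisticSlope b * ε * q) := by
        have h4 : (α * K - B) * (logisticSlope b * q) ≤ 1 + q ^ 2 := by
          have h5 : |(α * K - B) * (logisticSlope b * q)| ≤ 1 * (1 * |q|) := by
            rw [abs_mul, abs_mul]
            gcongr
            · rw [abs_le]; constructor <;> linarith
            · rw [abs_of_pos hsl]; linarith
          have h6 := le_abs_self ((α * K - B) * (logisticSlope b * q))
          nlinarith [sq_abs q, sq_nonneg (|q| - 1)]
        have := mul_le_mul_of_nonneg_left h4 hε.le
        linarith only [this]
      have h4 : (B : ℝ) * (ε ^ 2 * (1 + q ^ 2)) ≤ K * (ε ^ 2 * (1 + q ^ 2)) := by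
        have : (B : ℝ) ≤ K := by exact_mod_cast hBK
        gcongr
      linarith only [h2, h3, h4]
    have hN' : ε * k * N ≤ ε * (3 * k ^ 3) := by
      have h1 : k * 1 ≤ k * k ^ 2 := mul_le_mul_of_nonneg_left (one_le_pow₀ hk) hk0.le
      calc ε * k * N ≤ ε * k * (1 + 2 * k ^ 2) := mul_le_mul_of_nonneg_left hNle (by positivity)
        _ = ε * (k * 1 + 2 * k ^ 3) := by ring
        _ ≤ ε * (k * k ^ 2 + 2 * k ^ 3) := by gcongr
        _ = ε * (3 * k ^ 3) := by ring
    have hV' : K * V / (ε * k) ≤ ε * (k ^ 3 * (1 + q ^ 2)) := by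
      rw [div_le_iff₀ (by positivity), ← hkK]
      calc k ^ 4 * V ≤ k ^ 4 * (ε ^ 2 * (1 + q ^ 2)) := by gcongr
        _ = ε * (k ^ 3 * (1 + q ^ 2)) * (ε * k) := by ring
    have hM' := mul_le_mul_of_nonneg_left hM hK0
    have hk3 : 1 ≤ k ^ 3 := one_le_pow₀ hk
    -- The constant 5 + 2q² collects the k³ errors: 1 + q² from rounding `B`, 3 from the count and 1
    -- + q² from the variance. The ε² errors total only 2 + 2q².
    have e : ε * K * (logisticSlope b * (α * tailMean γ α) - (5 + 2 * q ^ 2) * (ε + 1 / k))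
        = K * (logisticSlope b * ε * α * tailMean γ α) - K * (ε ^ 2 * (5 + 2 * q ^ 2))
          - ε * (k ^ 3 * (5 + 2 * q ^ 2)) := by
      rw [← hkK]; field_simp; ring
    rw [e]
    have h7 : ε * (1 + q ^ 2) ≤ ε * (k ^ 3 * (1 + q ^ 2)) :=
      mul_le_mul_of_nonneg_left (le_mul_of_one_le_left (by positivity) hk3) hε.le
    have h8 : 0 ≤ K * ε ^ 2 := by positivity
    linarith only [h, hBτ, hM', hN', hV', h7, h8]

end Haystack

/-! ### Nonasymptotic bounds on the optimal gain -/

namespace Haystack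

/-- The variance of the score is controlled by the screening information. -/
lemma two_mul_variance_le {𝒵 : Type*} [MeasurableSpace 𝒵] {R : Measure (Bool × 𝒵)}
    [IsProbabilityMeasure R] {γ : Measure ℝ} [IsProbabilityMeasure γ] {b ε p : ℝ}
    (hscore : HasLogOddsScore R γ b ε) (hR : R.fst.real {true} = p)
    (hp : p ∈ Set.Ioo (0 : ℝ) 1) :
    2 * ∫ z, (bayesScore R z - p) ^ 2 ∂(R.snd) ≤ mutualInfoBits R * Real.log 2 := by
  rw [mutualInfoBits_mul_log_two hscore hR,
    integral_comp_bayesScore hscore (φ := fun x => (x - p) ^ 2) (by fun_prop)]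
  exact two_mul_integral_sq_le b ε hp

section Bounds

variable {𝒯 𝒱 𝒵 : Type*} [Fintype 𝒯] [MeasurableSpace 𝒯] [MeasurableSingletonClass 𝒯]
  [MeasurableSpace 𝒱] [MeasurableSpace 𝒵] (prior : Measure 𝒯) [IsProbabilityMeasure prior]
  (W : Kernel (𝒯 × Bool) 𝒱) [IsMarkovKernel W]
  {R : Measure (Bool × 𝒵)} [IsProbabilityMeasure R] {γ : Measure ℝ} {b ε p α : ℝ}

/-- Nonasymptotic converse bound for the optimal gain. -/
theorem optGain_le_sqrt (hW : IndepFun Prod.fst Prod.snd (stateOutputLaw prior W false))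
    [IsProbabilityMeasure γ] (hscore : HasLogOddsScore R γ b ε)
    (hR : R.fst.real {true} = p) (hp : p ∈ Set.Ioo (0 : ℝ) 1) (K B : ℕ) :
    optGain prior R W K B ≤ verInfo prior W *
      (B * p + Real.sqrt (Real.log 2 / 2 * (mutualInfoBits R * K * B))) := by
  have := nonempty_of_isProbabilityMeasure prior
  refine optGain_le prior W R hW (verInfo_nonneg prior W) (verInfo_le prior W)
    (lintegral_logLossBits_informativePosterior prior W) fun P => ?_
  refine (expectedHits_le_of_variance P hp.1.le).trans ?_
  have hV := two_mul_variance_le hscore hR hp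
  refine add_le_add le_rfl (Real.sqrt_le_sqrt ?_)
  calc (B : ℝ) * (K * ∫ z, (bayesScore R z - p) ^ 2 ∂(R.snd))
      ≤ B * (K * (mutualInfoBits R * Real.log 2 / 2)) := by gcongr; linarith
    _ = Real.log 2 / 2 * (mutualInfoBits R * K * B) := by ring

/-- Nonasymptotic achievability bound for the optimal gain. -/
theorem le_optGain_weak_screening
    (hW : IndepFun Prod.fst Prod.snd (stateOutputLaw prior W false)) (hγ : IsStandardScoreLaw γ)
    (hscore : HasLogOddsScore R γ b ε) (hε : 0 ≤ ε) (hR : R.fst.real {true} = p)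
    (hα : α ∈ Set.Ioo (0 : ℝ) 1) {K B : ℕ} (hB : B = ⌊α * (K : ℝ)⌋₊) {k : ℝ} (hk : 1 ≤ k)
    (hkK : k ^ 4 = K) :
    verInfo prior W * (B * p + ε * K * (logisticSlope b * (α * tailMean γ α)
        - (5 + 2 * upperQuantile γ α ^ 2) * (ε + 1 / k))) ≤ optGain prior R W K B := by
  have := nonempty_of_isProbabilityMeasure prior
  obtain ⟨P, hP⟩ := exists_policy_weak_screening hγ hscore hε hR hα hB hk hkK
  exact (mul_le_mul_of_nonneg_left hP (verInfo_nonneg prior W)).trans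
    (le_optGain prior W R P hW (verInfo_nonneg prior W) (verInfo_le prior W)
      (lintegral_logLossBits_informativePosterior prior W))

end Bounds

end Haystack

end

/-! ### The joint limit -/

theorem corollary2
    {𝒯 𝒱 : Type*} [Fintype 𝒯] [MeasurableSpace 𝒯] [MeasurableSingletonClass 𝒯]
    [MeasurableSpace 𝒱]
    -- the prior of a claim and the verification channel
    (prior : Measure 𝒯) [IsProbabilityMeasure prior]
    (W : Kernel (𝒯 × Bool) 𝒱) [IsMarkovKernel W]
    (hW : IndepFun Prod.fst Prod.snd (Haystack.stateOutputLaw prior W false))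
    -- the prevalence, the verification ratio and the law of the standardized score
    (p α : ℝ) (hp : p ∈ Set.Ioo (0 : ℝ) 1) (hα : α ∈ Set.Ioo (0 : ℝ) 1)
    (γ : Measure ℝ) (hγ : Haystack.IsStandardScoreLaw γ)
    -- a family of screening channels and pool sizes, along an arbitrary filter
    {ι : Type*} (l : Filter ι) {𝒵 : ι → Type*} [∀ n, MeasurableSpace (𝒵 n)]
    (R : ∀ n, Measure (Bool × 𝒵 n)) [∀ n, IsProbabilityMeasure (R n)]
    (hR : ∀ n, (R n).fst.real {true} = p)
    (b ε : ι → ℝ) (hε0 : ∀ n, 0 ≤ ε n)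
    (hscore : ∀ n, Haystack.HasLogOddsScore (R n) γ (b n) (ε n))
    (hε : Tendsto ε l (𝓝 0))
    (K : ι → ℕ) (hK : Tendsto K l atTop)
    (B : ι → ℕ) (hB : ∀ n, B n = ⌊α * (K n : ℝ)⌋₊)
    (J : ι → ℝ) (hJ : ∀ n, J n = Haystack.mutualInfoBits (R n)) :
    (∃ r : ι → ℝ,
      r =o[l] (fun n => Real.sqrt (J n * K n * B n)) ∧
      ∀ n, Haystack.verInfo prior W *
            (B n * p + Haystack.scoreConst γ p α * Real.sqrt (J n * K n * B n)) + r n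
          ≤ Haystack.optGain prior (R n) W (K n) (B n)) ∧
    (∀ n, Haystack.optGain prior (R n) W (K n) (B n)
          ≤ Haystack.verInfo prior W *
            (B n * p + Real.sqrt (Real.log 2 / 2 * (J n * K n * B n)))) ∧
    0 < Haystack.scoreConst γ p α := by
  open Haystack in
  have := hγ.prob
  have := nonempty_of_isProbabilityMeasure prior
  have hc := hγ.scoreConst_pos hp hα
  refine ⟨?_, fun n => ?_, hc⟩
  swap
  · rw [hJ n]
    exact optGain_le_sqrt prior W hW (hscore n) (hR n) hp (K n) (B n)
  set c := scoreConst γ p α with hcdef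
  set m := tailMean γ α with hm
  set I := verInfo prior W with hI
  set M := ∫ g, |g| ^ 3 ∂γ with hM
  set C := 5 + 2 * upperQuantile γ α ^ 2 with hC
  set s : ι → ℝ := fun n => Real.sqrt (J n * K n * B n) with hs
  set gain : ι → ℝ := fun n => optGain prior (R n) W (K n) (B n) with hgain
  set v := p * (1 - p) with hv
  have hv0 : 0 < v := mul_pos hp.1 (sub_pos.2 hp.2)
  have hl2 : 0 < Real.log 2 := Real.log_pos one_lt_two
  have hI0 : 0 ≤ I := verInfo_nonneg prior W
  have hM0 : 0 ≤ M := integral_nonneg fun g => by positivity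
  have hpσ : ∀ n, ∫ g, Real.sigmoid (b n + ε n * g) ∂γ = p := fun n => by
    rw [← hR n, ← integral_bayesScore]
    exact (integral_comp_bayesScore (hscore n) measurable_id).symm
  set k : ι → ℝ := fun n => Real.sqrt (Real.sqrt (K n)) with hk
  have hk4 : ∀ n, k n ^ 4 = K n := fun n => by
    rw [hk, show (4 : ℕ) = 2 * 2 by norm_num, pow_mul, Real.sq_sqrt (Real.sqrt_nonneg _),
      Real.sq_sqrt (Nat.cast_nonneg _)]
  have hKr : Tendsto (fun n => (K n : ℝ)) l atTop := tendsto_natCast_atTop_atTop.comp hK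
  have hkt : Tendsto k l atTop :=
    Real.tendsto_sqrt_atTop.comp (Real.tendsto_sqrt_atTop.comp hKr)
  have hslope : Tendsto (fun n => logisticSlope (b n)) l (𝓝 v) := by
    rw [tendsto_iff_norm_sub_tendsto_zero]
    refine squeeze_zero (fun n => norm_nonneg _)
      (fun n => hγ.abs_slope_sub_le (hpσ n) hp) ?_
    simpa using hε.pow 2
  -- In units of εK, `L` is the excess hits achieved and `U` an upper bound for √(JKB).
  set L : ι → ℝ := fun n => logisticSlope (b n) * (α * m) - C * (ε n + 1 / k n) with hL
  set U : ι → ℝ := fun n => Real.sqrt (α * (logisticSlope (b n) / 2 + ε n * M) / Real.log 2) with hU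
  have hLt : Tendsto L l (𝓝 (v * (α * m))) := by
    have h1 : Tendsto (fun n => 1 / k n) l (𝓝 0) := by
      simpa [Function.comp_def] using tendsto_inv_atTop_zero.comp hkt
    simpa [hL] using (hslope.mul_const (α * m)).sub ((hε.add h1).const_mul C)
  -- This fixes the value of `scoreConst`: √(2 ln 2 · vα) m times √(αv / (2 ln 2)) is v α m, the
  -- limit of `L`.
  have hUt : Tendsto (fun n => c * U n) l (𝓝 (v * (α * m))) := by
    have h1 : Tendsto (fun n => α * (logisticSlope (b n) / 2 + ε n * M) / Real.log 2) l
        (𝓝 (α * (v / 2 + 0 * M) / Real.log 2)) :=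
      (((hslope.div_const 2).add (hε.mul_const M)).const_mul α).div_const _
    have h2 := (h1.sqrt).const_mul c
    refine h2.trans (le_of_eq (congrArg 𝓝 ?_))
    have hA : 0 ≤ 2 * Real.log 2 * p * (1 - p) * α := by
      have := hp.1
      have := sub_pos.2 hp.2
      have := hα.1
      positivity
    rw [hcdef, scoreConst, ← hm, mul_right_comm, ← Real.sqrt_mul hA]
    have e : 2 * Real.log 2 * p * (1 - p) * α * (α * (v / 2 + 0 * M) / Real.log 2)
        = (v * α) ^ 2 := by rw [hv]; field_simp; ring
    rw [e, Real.sqrt_sq (mul_nonneg hv0.le hα.1.le)]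
    ring
  have hD : Tendsto (fun n => c * U n - L n) l (𝓝 0) := by simpa using hUt.sub hLt
  -- Taking the negative part of the deficit as remainder makes the inequality hold for every `n`,
  -- so only an eventual lower bound on the gain is needed.
  refine ⟨fun n => min 0 (gain n - I * (B n * p + c * s n)), ?_, fun n => ?_⟩
  swap
  · have := min_le_right 0 (gain n - I * (B n * p + c * s n))
    linarith
  have hBle : ∀ n, (B n : ℝ) ≤ α * K n := fun n => by
    rw [hB n]; exact Nat.floor_le (mul_nonneg hα.1.le (Nat.cast_nonneg _))
  have hsU : ∀ n, s n ≤ ε n * K n * U n := by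
    intro n
    have hJn : J n ≤ ε n ^ 2 * (logisticSlope (b n) / 2 + ε n * M) / Real.log 2 := by
      rw [le_div_iff₀ hl2, hJ n, mutualInfoBits_mul_log_two (hscore n) (hR n)]
      refine (hγ.integral_bernoulliDiv_le (hε0 n) (hpσ n) hp).trans (le_of_eq ?_)
      ring
    have hJ0 : 0 ≤ J n := by rw [hJ n]; exact mutualInfoBits_nonneg _
    have h0 : 0 ≤ ε n * K n := mul_nonneg (hε0 n) (Nat.cast_nonneg _)
    rw [← Real.sqrt_sq h0, hs, hU, ← Real.sqrt_mul (sq_nonneg _)]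
    refine Real.sqrt_le_sqrt ?_
    calc J n * K n * B n ≤ J n * K n * (α * K n) := by gcongr; exact hBle n
      _ ≤ (ε n ^ 2 * (logisticSlope (b n) / 2 + ε n * M) / Real.log 2) * K n * (α * K n) := by
        have := hα.1
        gcongr
      _ = _ := by ring
  have hr : (fun n => min 0 (gain n - I * (B n * p + c * s n)))
      =O[l] fun n => (ε n * K n) * (c * U n - L n) := by
    refine IsBigO.of_bound I ?_
    filter_upwards [hkt.eventually_ge_atTop 1] with n hn
    have h1 := le_optGain_weak_screening prior W hW hγ (hscore n) (hε0 n) (hR n) hα (hB n) hn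
      (hk4 n)
    have h2 : I * (B n * p + ε n * K n * L n) ≤ gain n := h1
    have h0 : 0 ≤ ε n * K n := mul_nonneg (hε0 n) (Nat.cast_nonneg _)
    have h3 : I * (B n * p + c * s n) - gain n ≤ I * |ε n * K n * (c * U n - L n)| := by
      have h4 := mul_le_mul_of_nonneg_left (hsU n) hc.le
      have h5 := le_abs_self (ε n * K n * (c * U n - L n))
      have h6 : c * s n - ε n * K n * L n ≤ |ε n * K n * (c * U n - L n)| := by
        linarith only [h4, h5]
      have h7 := mul_le_mul_of_nonneg_left h6 hI0
      linarith only [h2, h7]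
    have h8 : 0 ≤ I * |ε n * K n * (c * U n - L n)| := mul_nonneg hI0 (abs_nonneg _)
    rw [Real.norm_eq_abs, Real.norm_eq_abs, abs_of_nonpos (min_le_left _ _), neg_le]
    refine le_min ?_ ?_ <;> linarith
  have hlo : (fun n => (ε n * K n) * (c * U n - L n)) =o[l] fun n => ε n * K n := by
    simpa using (isBigO_refl (fun n => ε n * (K n : ℝ)) l).mul_isLittleO
      ((isLittleO_one_iff ℝ).2 hD)
  -- Errors were measured against εK. Pinsker together with the variance lower bound gives J at
  -- least of order ε², so εK is controlled by √(JKB); when ε = 0 the inequality is trivial.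
  have hbig : (fun n => ε n * (K n : ℝ)) =O[l] s := by
    have hw0 : 0 < Real.sqrt (α / Real.log 2) * (v / 2) :=
      mul_pos (Real.sqrt_pos.2 (div_pos hα.1 hl2)) (half_pos hv0)
    refine IsBigO.of_bound (Real.sqrt (α / Real.log 2) * (v / 2))⁻¹ ?_
    have ht : Tendsto (fun n => logisticSlope (b n) - ε n * M) l (𝓝 v) := by
      simpa using hslope.sub (hε.mul_const M)
    filter_upwards [ht.eventually (lt_mem_nhds (half_lt_self hv0)),
      hKr.eventually_ge_atTop (2 / α)] with n hn hKn
    have h0 : 0 ≤ ε n * K n := mul_nonneg (hε0 n) (Nat.cast_nonneg _)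
    -- Once αK ≥ 2, the floor loses at most half of αK.
    have hBge : α * K n / 2 ≤ B n := by
      have h1 : α * K n < B n + 1 := by rw [hB n]; exact Nat.lt_floor_add_one _
      rw [div_le_iff₀ hα.1] at hKn
      linarith
    have ht0 : ε n * (v / 2) ≤ logisticSlope (b n) * ε n - ε n ^ 2 * M := by
      have := mul_le_mul_of_nonneg_left hn.le (hε0 n)
      linarith
    have hJge : 2 * (ε n * (v / 2)) ^ 2 / Real.log 2 ≤ J n := by
      rw [div_le_iff₀ hl2, hJ n]
      refine le_trans ?_ (two_mul_variance_le (hscore n) (hR n) hp)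
      have hnn : 0 ≤ ε n * (v / 2) := mul_nonneg (hε0 n) (half_pos hv0).le
      have h1 := hγ.sq_le_integral_sq (b := b n) (ε := ε n) (p := p) (hnn.trans ht0)
      rw [integral_comp_bayesScore (hscore n) (φ := fun x => (x - p) ^ 2) (by fun_prop)]
      have h2 := pow_le_pow_left₀ hnn ht0 2
      linarith
    have hkey : ε n * K n * (Real.sqrt (α / Real.log 2) * (v / 2)) ≤ s n := by
      refine Real.le_sqrt_of_sq_le ?_
      have hJ0 : 0 ≤ J n := by rw [hJ n]; exact mutualInfoBits_nonneg _
      calc (ε n * K n * (Real.sqrt (α / Real.log 2) * (v / 2))) ^ 2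
          = (2 * (ε n * (v / 2)) ^ 2 / Real.log 2) * K n * (α * K n / 2) := by
            rw [mul_pow, mul_pow (Real.sqrt _), Real.sq_sqrt (div_pos hα.1 hl2).le]
            field_simp
        _ ≤ J n * K n * (α * K n / 2) := by
            have := hα.1
            gcongr
        _ ≤ J n * K n * B n := by gcongr
    rw [Real.norm_of_nonneg h0, Real.norm_of_nonneg (Real.sqrt_nonneg _), inv_mul_eq_div,
      le_div_iff₀ hw0]
    exact hkey
  exact (hr.trans_isLittleO hlo).trans_isBigO hbig
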